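/- Let $W$ be a binary erasure channel with erasure probability $p\in[0,1]$, let $Z(\cdot)$ denote the Bhattacharyya parameter and $I(\cdot)$ the symmetric capacity of a binary-input channel, and let $w^\flat,w^\sharp$ be the two channels that Arıkan's transform makes out of two independent copies of $w$: with inputs $u_1+u_2$ and $u_2$ to the copies and outputs $y_1,y_2$, the channel $w^\flat$ is $u_1\mapsto(y_1,y_2)$ and $w^\sharp$ is $u_2\mapsto(y_1,y_2,u_1)$, the other input being uniform. For $0<\varepsilon<1$ put $n=\lceil-5\log_2\varepsilon\rceil$. Grow a rooted binary tree $\mathcal T$ of channels from the root $W$: a vertex $w$ receives the children $w^\flat,w^\sharp$ if and only if its depth is less than $n$ and $\min\{Z(w),1-Z(w)\}>\varepsilon2^{-n}$. Let $\mathcal A$ be the set of leaves $w$ with $Z(w)\le\varepsilon2^{-n}$. The pruned polar code of $(\mathcal T,\mathcal A)$ uses $W$ independently $N=2^n$ times; its circuit provides $2^{n-d}$ copies of each leaf channel of depth $d$, on which information bits are sent if the leaf is in $\mathcal A$ and the symbol $0$ otherwise; it is decoded by successive cancellation. Let $K$ be the number of information bits, $R=K/N$ the rate, and let $\tau$ be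 the depth of the leaf that is reached when one walks from the root and chooses either child with probability $1/2$ at each step. Complexity is the number of gates of a straight-line program (circuit) in which each gate evaluates a constant or an operation of two symbols over the alphabet $\{0,1\}$ (encoder) or $\{0,1,?\}$ (decoder). Then there are constants $C,\varepsilon_0>0$, depending only on $W$, such that for all $0<\varepsilon<\varepsilon_0$: 1. $\varepsilon^{-5}\le N<2\varepsilon^{-5}$, with $N=\varepsilon^{-5}$ whenever $\varepsilon^{-5}$ is a power of $2$; if $0<p<1$, then $\mathcal T$ has depth exactly $n$, so $N=2^{\operatorname{depth}(\mathcal T)}$; 2. $R\ge I(W)-\varepsilon$; 3. for every message the block error probability is at most $\varepsilon$; 4. $\mathbb E[\tau]\le C\log\log(1/\varepsilon)$, and, if $p<1$, then $K>0$ and the encoder and the successive cancellation decoder can each be computed with at most $C\log\log(1/\varepsilon)$ gates per information bit, and likewise with at most $C\log\log N$ gates per information bit. -/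

import Mathlib

noncomputable section

namespace PrunedPolar

/-- A discrete memoryless channel with input alphabet `𝔽₂` and a finite output alphabet:
`prob x y` is the probability of receiving `y` when `x` is sent. -/
structure Channel where
  Out : Type
  [fintypeOut : Fintype Out]
  prob : ZMod 2 → Out → ℝ
  prob_nonneg : ∀ x y, 0 ≤ prob x y
  sum_prob : ∀ x, ∑ y, prob x y = 1

attribute [instance] Channel.fintypeOut

/-- Transition probabilities of the binary erasure channel with erasure probability `p`;
the output `none` is the erasure symbol. -/
def becProb (p : ℝ) (x : ZMod 2) (y : Option (ZMod 2)) : ℝ :=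
  if y = none then p else if y = some x then 1 - p else 0

/-- The binary erasure channel with erasure probability `p`. -/
def bec (p : ℝ) (h0 : 0 ≤ p) (h1 : p ≤ 1) : Channel where
  Out := Option (ZMod 2)
  prob := becProb p
  prob_nonneg := by
    intro x y
    unfold becProb
    split_ifs <;> linarith
  sum_prob := by
    intro x
    simp [becProb, Fintype.sum_option]

namespace Channel

/-- The Bhattacharyya parameter `Z(W) = ∑_y √(W(y|0) W(y|1))`. -/
def bhattacharyya (W : Channel) : ℝ := ∑ y, √(W.prob 0 y * W.prob 1 y)

/-- The symmetric capacity, in bits: the mutual information between a uniform input and the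
corresponding output. -/
def capacity (W : Channel) : ℝ :=
  ∑ y, ∑ x : ZMod 2,
    1 / 2 * W.prob x y *
      Real.logb 2 (W.prob x y / (1 / 2 * W.prob 0 y + 1 / 2 * W.prob 1 y))

/-- The upper child `W♭` of Arıkan's transform: two independent copies of `W` have the inputs
`u₁ + u₂` and `u₂` with `u₂` uniform; the channel goes from `u₁` to `(y₁, y₂)`. -/
def flat (W : Channel) : Channel where
  Out := W.Out × W.Out
  prob u₁ y := ∑ u₂ : ZMod 2, 1 / 2 * W.prob (u₁ + u₂) y.1 * W.prob u₂ y.2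
  prob_nonneg u₁ y := Finset.sum_nonneg fun u₂ _ =>
    mul_nonneg (mul_nonneg (by norm_num) (W.prob_nonneg _ _)) (W.prob_nonneg _ _)
  sum_prob u₁ := by
    rw [Finset.sum_comm]
    have h : ∀ u₂ : ZMod 2, ∑ y : W.Out × W.Out,
        1 / 2 * W.prob (u₁ + u₂) y.1 * W.prob u₂ y.2 = 1 / 2 := by
      intro u₂
      rw [Fintype.sum_prod_type]
      simp_rw [← Finset.mul_sum, W.sum_prob, mul_one, ← Finset.mul_sum, W.sum_prob, mul_one]
    simp_rw [h]
    simp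

/-- The lower child `W♯` of Arıkan's transform: two independent copies of `W` have the inputs
`u₁ + u₂` and `u₂` with `u₁` uniform; the channel goes from `u₂` to `(y₁, y₂, u₁)`. -/
def sharp (W : Channel) : Channel where
  Out := W.Out × W.Out × ZMod 2
  prob u₂ y := 1 / 2 * W.prob (y.2.2 + u₂) y.1 * W.prob u₂ y.2.1
  prob_nonneg u₂ y :=
    mul_nonneg (mul_nonneg (by norm_num) (W.prob_nonneg _ _)) (W.prob_nonneg _ _)
  sum_prob u₂ := by
    have h : ∀ u₁ : ZMod 2, ∑ y₁, ∑ y₂,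
        1 / 2 * W.prob (u₁ + u₂) y₁ * W.prob u₂ y₂ = 1 / 2 := by
      intro u₁
      simp_rw [← Finset.mul_sum, W.sum_prob, mul_one, ← Finset.mul_sum, W.sum_prob, mul_one]
    rw [Fintype.sum_prod_type]
    simp_rw [Fintype.sum_prod_type]
    have h' : ∀ y₁, ∑ y₂, ∑ u₁ : ZMod 2, 1 / 2 * W.prob (u₁ + u₂) y₁ * W.prob u₂ y₂
        = ∑ u₁ : ZMod 2, ∑ y₂, 1 / 2 * W.prob (u₁ + u₂) y₁ * W.prob u₂ y₂ :=
      fun y₁ => Finset.sum_comm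
    simp_rw [h']
    rw [Finset.sum_comm]
    simp_rw [h]
    simp

end Channel

/-- The `2 ^ n` sequences of `n` coin tosses (`false`: go to the upper child `♭`, `true`: go to
the lower child `♯`). They also index the `2 ^ n` coordinates of a block. -/
abbrev Pos (n : ℕ) : Type := Fin n → Bool

/-- Put together a block of length `2 ^ (n + 1)` from its two halves. -/
def join {A : Type} {n : ℕ} (a b : Pos n → A) : Pos (n + 1) → A :=
  fun s => if s 0 then b (Fin.tail s) else a (Fin.tail s)

/-- The first half of a block. -/
def half₀ {A : Type} {n : ℕ} (x : Pos (n + 1) → A) : Pos n → A := fun s => x (Fin.cons false s)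

/-- The second half of a block. -/
def half₁ {A : Type} {n : ℕ} (x : Pos (n + 1) → A) : Pos n → A := fun s => x (Fin.cons true s)

/-- A pair `(𝒯, 𝒜)`: a rooted binary tree `𝒯` of depth at most `n`, in which `node` means that
Arıkan's transform is applied to the channel at that vertex (first the `♭` child, then the `♯`
child), and a set `𝒜` of leaves, namely the leaves labelled `true`. The corresponding circuit
consumes `2 ^ n` copies of the root channel and provides `2 ^ (n - d)` copies of each leaf
channel at depth `d`. -/
inductive PrunedTree : ℕ → Type
  | leaf {n : ℕ} (utilized : Bool) : PrunedTree n
  | node {n : ℕ} (l r : PrunedTree n) : PrunedTree (n + 1)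

namespace PrunedTree

/-- The depth of the deepest leaf. -/
def depth : {n : ℕ} → PrunedTree n → ℕ
  | _, leaf _ => 0
  | _, node l r => max l.depth r.depth + 1

/-- The stopping time `τ`: the depth of the leaf that is reached by following the tosses. -/
def stopTime : {n : ℕ} → PrunedTree n → Pos n → ℕ
  | _, leaf _, _ => 0
  | _, node l r, s => (if s 0 then r.stopTime (Fin.tail s) else l.stopTime (Fin.tail s)) + 1

/-- Whether the leaf `K_τ` that is reached by following the tosses belongs to `𝒜`. -/
def utilized : {n : ℕ} → PrunedTree n → Pos n → Bool
  | _, leaf b, _ => b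
  | _, node l r, s => if s 0 then r.utilized (Fin.tail s) else l.utilized (Fin.tail s)

/-- The expectation `𝔼[τ]` for independent fair coin tosses. -/
def expectedStopTime {n : ℕ} (T : PrunedTree n) : ℝ := (∑ s, (T.stopTime s : ℝ)) / 2 ^ n

/-- The coordinates that carry information: one for every copy of every leaf channel in `𝒜`.
All the other coordinates are frozen to `0`. -/
abbrev InfoPos {n : ℕ} (T : PrunedTree n) : Type := {s : Pos n // T.utilized s = true}

/-- The block length `N`: the number of copies of the root channel. -/
def blockLength {n : ℕ} (_T : PrunedTree n) : ℕ := Fintype.card (Pos n)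

/-- The number of information bits of a block. -/
def dimension {n : ℕ} (T : PrunedTree n) : ℕ := Fintype.card T.InfoPos

/-- The code rate: the number of information bits divided by the block length (which is
the probability that `K_τ` is in `𝒜`). -/
def rate {n : ℕ} (T : PrunedTree n) : ℝ := (T.dimension : ℝ) / T.blockLength

/-- The encoding circuit on the inputs of all leaf channels. At a node, the inputs `a` of the
`♭` channels and `b` of the `♯` channels are combined by butterfly devices `(a, b) ↦ (a + b, b)`. -/
def transform : {n : ℕ} → PrunedTree n → (Pos n → ZMod 2) → (Pos n → ZMod 2)
  | _, leaf _, u => u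
  | _, node l r, u =>
      join (fun s => l.transform (half₀ u) s + r.transform (half₁ u) s) (r.transform (half₁ u))

/-- The encoder: transmit the message through the leaf channels in `𝒜`, and `0` through the
remaining ones. -/
def encode {n : ℕ} (T : PrunedTree n) (m : T.InfoPos → ZMod 2) : Pos n → ZMod 2 :=
  T.transform fun s => if h : T.utilized s = true then m ⟨s, h⟩ else 0

/-- Successive cancellation. From the received symbols (`none` is an erasure) it computes the
decisions on the inputs of all leaf channels and the resulting decisions on the inputs of the
root channels. At a node, the `♭` channels are decoded first, from the sums of the two received
symbols; then the `♯` channels are decoded, where `b` is known from `y₁ = b`, or from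
`y₀ = a + b` and the decision on `a`. -/
def decodeAux : {n : ℕ} → PrunedTree n → (Pos n → Option (ZMod 2)) →
    (Pos n → Option (ZMod 2)) × (Pos n → Option (ZMod 2))
  | _, leaf b, y => if b = true then (y, y) else (fun _ => some 0, fun _ => some 0)
  | _, node l r, y =>
      let L := l.decodeAux fun s => Option.map₂ (· + ·) (half₀ y s) (half₁ y s)
      let R := r.decodeAux fun s =>
        (half₁ y s).or (Option.map₂ (· + ·) (L.2 s) (half₀ y s))
      (join L.1 R.1, join (fun s => Option.map₂ (· + ·) (L.2 s) (R.2 s)) R.2)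

/-- The successive cancellation decoder: the decisions on the information bits, where `none`
is a declared failure. -/
def decode {n : ℕ} (T : PrunedTree n) (y : Pos n → Option (ZMod 2)) :
    T.InfoPos → Option (ZMod 2) :=
  fun i => (T.decodeAux y).1 i.1

open Classical in
/-- The block error probability over the binary erasure channel when the message `m` is sent:
the probability, over independent uses of the channel, that the decoder does not return the
message (wrong decisions and declared failures both count as errors). -/
def errorProb {n : ℕ} (T : PrunedTree n) (p : ℝ) (h0 : 0 ≤ p) (h1 : p ≤ 1)
    (m : T.InfoPos → ZMod 2) : ℝ :=
  ∑ y : Pos n → Option (ZMod 2),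
    if T.decode y = (fun i => some (m i)) then 0
    else ∏ s, (bec p h0 h1).prob (T.encode m s) (y s)

end PrunedTree

/-- `grow θ k w` is the tree grown from a vertex with channel `w` that lies `k` levels above the
maximal depth: Arıkan's transform is applied if and only if the maximal depth is not reached and
`min {Z(w), 1 - Z(w)} > θ`. A leaf is in `𝒜` if and only if `Z(w) ≤ θ`. -/
def grow (θ : ℝ) : (k : ℕ) → Channel → PrunedTree k
  | 0, w => .leaf (decide (w.bhattacharyya ≤ θ))
  | k + 1, w =>
      if θ < min w.bhattacharyya (1 - w.bhattacharyya) then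
        .node (grow θ k w.flat) (grow θ k w.sharp)
      else .leaf (decide (w.bhattacharyya ≤ θ))

/-- The maximal depth `n = -5 log₂ ε`, rounded up to an integer. -/
def maxDepth (ε : ℝ) : ℕ := ⌈-5 * Real.logb 2 ε⌉₊

/-- The pruned polar code for the channel `W` with parameter `ε`; the threshold
is `ε 2 ^ (-n)`. -/
def prunedPolarCode (W : Channel) (ε : ℝ) : PrunedTree (maxDepth ε) :=
  grow (ε / 2 ^ maxDepth ε) (maxDepth ε) W

/-- `StraightLine t S`: some straight-line program (circuit) with `t` gates over the alphabet `A`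
computes, from the input symbols `x k`, the set `S` of functions of the input (the inputs
themselves and the values of all gates). Every gate evaluates a constant or an operation of
two symbols on values that are already there, and costs one unit of time. -/
inductive StraightLine {κ A : Type} : ℕ → Set ((κ → A) → A) → Prop
  | input : StraightLine 0 (Set.range fun k x => x k)
  | const {t : ℕ} {S : Set ((κ → A) → A)} (a : A) (hS : StraightLine t S) :
      StraightLine (t + 1) (insert (fun _ => a) S)
  | gate {t : ℕ} {S : Set ((κ → A) → A)} (op : A → A → A) (f g : (κ → A) → A)
      (hS : StraightLine t S) (hf : f ∈ S) (hg : g ∈ S) :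
      StraightLine (t + 1) (insert (fun x => op (f x) (g x)) S)

/-- All the output symbols of `F` can be computed by one straight-line program of at most `b`
gates. -/
def ComputableIn {κ ι A : Type} (F : (κ → A) → ι → A) (b : ℝ) : Prop :=
  ∃ (t : ℕ) (S : Set ((κ → A) → A)), StraightLine t S ∧ (∀ i, (fun x => F x i) ∈ S) ∧ (t : ℝ) ≤ b

end PrunedPolar

end

open PrunedPolar

/-! Both of Arıkan's children of an erasure channel are again erasure-like, so the whole tree is
governed by the erasure probability: z goes to 2z - z² or z², and its mean over the fair toss stays
z. Write q = z(1 - z).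

Error: successive cancellation over erasures never decides wrongly while every utilized leaf symbol
so far is unerased. A union bound over at most 2^n utilized symbols, each erased with probability at
most ε 2^(-n), gives ε (`failProb_growBEC_le`).

Rate: by the martingale property the rate falls short of 1 - p by at most the threshold plus the
probability of being unpolarized at depth n. The mean of √q shrinks by √3/2 < 2^(-1/5) per step, but
√q can be as small as about ε³ at an unpolarized vertex, so Markov's inequality would lose too much.
Adding a small multiple of q^(1/200) keeps nearly the same decay and makes that loss only ε^(3/100)
(`polarization_children`, `le_rate_growBEC`).

Complexity: the number of butterflies is N E[τ] / 2, with boundedly many gates each. One child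
roughly squares q while the other at most doubles it, so log(-log q), corrected by -40√q, rises on
average by at least 1/8 per step. Pruning caps it near log log(1/ε), which bounds E[τ]
(`logLogVar_drift`, `expectedStopTime_growBEC_le`). -/

open PrunedPolar

namespace PrunedPolar

/-! ### Erasure-like channels under Arıkan's transform -/

namespace Channel

/-- Every output symbol either reveals the input or is independent of it. -/
def IsErasure (w : Channel) : Prop :=
  ∀ y, w.prob 0 y = w.prob 1 y ∨ w.prob 0 y = 0 ∨ w.prob 1 y = 0

theorem isErasure_bec (p : ℝ) (h0 : 0 ≤ p) (h1 : p ≤ 1) : (bec p h0 h1).IsErasure := by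
  intro y
  rcases y with _ | y
  · left; simp [bec, becProb]
  · right
    have hy : y = 0 ∨ y = 1 := by revert y; decide
    rcases hy with rfl | rfl <;> simp [bec, becProb]

theorem bhattacharyya_bec (p : ℝ) (h0 : 0 ≤ p) (h1 : p ≤ 1) :
    (bec p h0 h1).bhattacharyya = p := by
  have e : (Finset.univ : Finset (ZMod 2)) = {0, 1} := rfl
  simp only [bhattacharyya]
  change ∑ y : Option (ZMod 2), √(becProb p 0 y * becProb p 1 y) = p
  rw [Fintype.sum_option, e, Finset.sum_pair (by decide)]
  simp [becProb, Real.sqrt_mul_self h0]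

theorem capacity_bec (p : ℝ) (h0 : 0 ≤ p) (h1 : p ≤ 1) :
    (bec p h0 h1).capacity = 1 - p := by
  have e : (Finset.univ : Finset (ZMod 2)) = {0, 1} := rfl
  simp only [capacity]
  change ∑ y : Option (ZMod 2), ∑ x : ZMod 2, 1 / 2 * becProb p x y *
    Real.logb 2 (becProb p x y / (1 / 2 * becProb p 0 y + 1 / 2 * becProb p 1 y)) = 1 - p
  simp only [Fintype.sum_option, e, Finset.sum_pair (show (0 : ZMod 2) ≠ 1 by decide)]
  have h2 : Real.logb 2 2 = 1 := Real.logb_self_eq_one (by norm_num)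
  have hp : p * Real.logb 2 (p / (2⁻¹ * p + 2⁻¹ * p)) = 0 := by
    rw [show 2⁻¹ * p + 2⁻¹ * p = p by ring]
    rcases eq_or_ne p 0 with h | h
    · simp [h]
    · simp [div_self h]
  have hq : (1 - p) * Real.logb 2 ((1 - p) / (2⁻¹ * (1 - p))) = 1 - p := by
    rcases eq_or_ne (1 - p) 0 with h | h
    · simp [h]
    · rw [show (1 - p) / (2⁻¹ * (1 - p)) = 2 by field_simp, h2, mul_one]
  simp [becProb]
  linarith

theorem prob_flat_zero (w : Channel) (y : w.Out × w.Out) : w.flat.prob 0 y =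
    1 / 2 * w.prob 0 y.1 * w.prob 0 y.2 + 1 / 2 * w.prob 1 y.1 * w.prob 1 y.2 := by
  have e : (Finset.univ : Finset (ZMod 2)) = {0, 1} := rfl
  simp [flat, e]

theorem prob_flat_one (w : Channel) (y : w.Out × w.Out) : w.flat.prob 1 y =
    1 / 2 * w.prob 1 y.1 * w.prob 0 y.2 + 1 / 2 * w.prob 0 y.1 * w.prob 1 y.2 := by
  have e : (Finset.univ : Finset (ZMod 2)) = {0, 1} := rfl
  have e' : (1 + 1 : ZMod 2) = 0 := rfl
  simp [flat, e, e']

theorem IsErasure.flat {w : Channel} (hw : w.IsErasure) : w.flat.IsErasure := by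
  intro (y : w.Out × w.Out)
  rw [prob_flat_zero, prob_flat_one]
  rcases hw y.1 with h | h | h <;> rcases hw y.2 with h' | h' | h' <;> simp [h, h']

theorem IsErasure.sharp {w : Channel} (hw : w.IsErasure) : w.sharp.IsErasure := by
  rintro ⟨y₁, y₂, u⟩
  have e' : (1 + 1 : ZMod 2) = 0 := rfl
  change 1 / 2 * w.prob (u + 0) y₁ * w.prob 0 y₂ = 1 / 2 * w.prob (u + 1) y₁ * w.prob 1 y₂ ∨
    1 / 2 * w.prob (u + 0) y₁ * w.prob 0 y₂ = 0 ∨ 1 / 2 * w.prob (u + 1) y₁ * w.prob 1 y₂ = 0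
  have hu : u = 0 ∨ u = 1 := by revert u; decide
  rcases hu with rfl | rfl <;> rcases hw y₁ with h | h | h <;> rcases hw y₂ with h' | h' | h' <;>
    simp [h, h', e']

theorem bhattacharyya_sharp (w : Channel) :
    w.sharp.bhattacharyya = w.bhattacharyya ^ 2 := by
  have e : (Finset.univ : Finset (ZMod 2)) = {0, 1} := rfl
  have e' : (1 + 1 : ZMod 2) = 0 := rfl
  have key : ∀ y₁ y₂, ∀ u : ZMod 2,
      √((1 / 2 * w.prob (u + 0) y₁ * w.prob 0 y₂) * (1 / 2 * w.prob (u + 1) y₁ * w.prob 1 y₂))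
        = 1 / 2 * (√(w.prob 0 y₁ * w.prob 1 y₁) * √(w.prob 0 y₂ * w.prob 1 y₂)) := by
    intro y₁ y₂ u
    have hu : u = 0 ∨ u = 1 := by revert u; decide
    have : (1 / 2 * w.prob (u + 0) y₁ * w.prob 0 y₂) * (1 / 2 * w.prob (u + 1) y₁ * w.prob 1 y₂)
        = (1 / 2) ^ 2 * ((w.prob 0 y₁ * w.prob 1 y₁) * (w.prob 0 y₂ * w.prob 1 y₂)) := by
      rcases hu with rfl | rfl
      · simp only [add_zero, zero_add]; ring
      · simp only [add_zero, e']; ring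
    rw [this, Real.sqrt_mul (by positivity), Real.sqrt_sq (by norm_num),
      Real.sqrt_mul (mul_nonneg (w.prob_nonneg _ _) (w.prob_nonneg _ _))]
  change ∑ y : w.Out × w.Out × ZMod 2, √((1 / 2 * w.prob (y.2.2 + 0) y.1 * w.prob 0 y.2.1) *
    (1 / 2 * w.prob (y.2.2 + 1) y.1 * w.prob 1 y.2.1)) = _
  simp only [Fintype.sum_prod_type, key, e, Finset.sum_pair (show (0 : ZMod 2) ≠ 1 by decide)]
  rw [sq, bhattacharyya, Finset.sum_mul_sum]
  refine Finset.sum_congr rfl fun _ _ => Finset.sum_congr rfl fun _ _ => ?_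
  ring

/-- For general channels this is only an upper bound. Here every output is ambiguous or revealing,
so `key` is inclusion-exclusion for "one of the two outputs is ambiguous": m₁e₂ + e₁m₂ - e₁e₂, where
m is the mean output mass and e its ambiguous part. -/
theorem bhattacharyya_flat {w : Channel} (hw : w.IsErasure) :
    w.flat.bhattacharyya = 2 * w.bhattacharyya - w.bhattacharyya ^ 2 := by
  have key : ∀ y : w.Out × w.Out, √(w.flat.prob 0 y * w.flat.prob 1 y) =
      1 / 2 * (w.prob 0 y.1 + w.prob 1 y.1) * √(w.prob 0 y.2 * w.prob 1 y.2) +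
      1 / 2 * √(w.prob 0 y.1 * w.prob 1 y.1) * (w.prob 0 y.2 + w.prob 1 y.2) -
      √(w.prob 0 y.1 * w.prob 1 y.1) * √(w.prob 0 y.2 * w.prob 1 y.2) := by
    intro y
    rw [prob_flat_zero, prob_flat_one]
    have a := w.prob_nonneg 1 y.1
    have b := w.prob_nonneg 1 y.2
    have a' := w.prob_nonneg 0 y.1
    have b' := w.prob_nonneg 0 y.2
    rcases hw y.1 with h | h | h <;> rcases hw y.2 with h' | h' | h' <;> rw [h, h'] <;>
      simp only [Real.sqrt_mul_self a, Real.sqrt_mul_self b, mul_zero, zero_mul, Real.sqrt_zero,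
        add_zero, zero_add, sub_zero]
    · rw [Real.sqrt_mul_self (by positivity)]; ring
    · rw [Real.sqrt_mul_self (by positivity)]
    · rw [Real.sqrt_mul_self (by positivity)]
    · rw [Real.sqrt_eq_iff_mul_self_eq] <;> positivity
    · rw [Real.sqrt_eq_iff_mul_self_eq] <;> positivity
  have h0 := w.sum_prob 0
  have h1 := w.sum_prob 1
  change ∑ y : w.Out × w.Out, √(w.flat.prob 0 y * w.flat.prob 1 y) = _
  simp only [key, Finset.sum_sub_distrib, Finset.sum_add_distrib, Fintype.sum_prod_type,
    ← Finset.mul_sum, ← Finset.sum_mul, h0, h1]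
  simp only [bhattacharyya]
  ring

end Channel

/-! ### The tree as a recursion on the erasure probability -/

/-- The pruned tree in terms of the erasure probability `z` at the root. -/
noncomputable def growBEC (θ : ℝ) : (k : ℕ) → ℝ → PrunedTree k
  | 0, z => .leaf (decide (z ≤ θ))
  | k + 1, z =>
      if θ < min z (1 - z) then .node (growBEC θ k (2 * z - z ^ 2)) (growBEC θ k (z ^ 2))
      else .leaf (decide (z ≤ θ))

theorem grow_eq_growBEC (θ : ℝ) (k : ℕ) {w : Channel} (hw : w.IsErasure) :
    grow θ k w = growBEC θ k w.bhattacharyya := by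
  induction k generalizing w with
  | zero => rfl
  | succ k ih =>
    simp only [grow, growBEC]
    rw [ih hw.flat, ih hw.sharp, Channel.bhattacharyya_flat hw, Channel.bhattacharyya_sharp]

theorem prunedPolarCode_bec (p : ℝ) (h0 : 0 ≤ p) (h1 : p ≤ 1) (ε : ℝ) :
    prunedPolarCode (bec p h0 h1) ε = growBEC (ε / 2 ^ maxDepth ε) (maxDepth ε) p := by
  rw [prunedPolarCode, grow_eq_growBEC _ _ (Channel.isErasure_bec p h0 h1),
    Channel.bhattacharyya_bec]

/-! ### Random erasure patterns -/

/-- Push forward a product weight along a letterwise map. -/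
theorem sum_comp_mul_prod {ι A B : Type} [Fintype ι] [DecidableEq ι] [Fintype A] [Fintype B]
    [DecidableEq B] (φ : A → B) (w : ι → A → ℝ) (G : (ι → B) → ℝ) :
    ∑ f : ι → A, G (fun i => φ (f i)) * ∏ i, w i (f i) =
      ∑ g : ι → B, G g * ∏ i, ∑ a, if φ a = g i then w i a else 0 := by
  classical
  have h1 : ∀ g : ι → B, G g * ∏ i, (∑ a, if φ a = g i then w i a else 0) =
      ∑ f : ι → A, if (fun i => φ (f i)) = g then G g * ∏ i, w i (f i) else 0 := by
    intro g
    rw [Finset.prod_univ_sum, Fintype.piFinset_univ, Finset.mul_sum]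
    refine Finset.sum_congr rfl fun f _ => ?_
    split_ifs with h
    · subst h; simp
    · obtain ⟨i, hi⟩ := Function.ne_iff.1 h
      rw [Finset.prod_eq_zero (Finset.mem_univ i) (if_neg hi), mul_zero]
  simp_rw [h1]
  rw [Finset.sum_comm]
  simp

/-- The weight of one letter of an erasure pattern (`true` is an erasure). -/
def erasureWeight (z : ℝ) (b : Bool) : ℝ := if b then z else 1 - z

theorem erasureWeight_nonneg {z : ℝ} (h0 : 0 ≤ z) (h1 : z ≤ 1) (b : Bool) :
    0 ≤ erasureWeight z b := by
  cases b <;> simp [erasureWeight] <;> linarith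

theorem sum_erasureWeight (z : ℝ) : ∑ b, erasureWeight z b = 1 := by
  simp [erasureWeight]

theorem half₀_join {A : Type} {n : ℕ} (a b : Pos n → A) : half₀ (join a b) = a := by
  funext s; simp [half₀, join]

theorem half₁_join {A : Type} {n : ℕ} (a b : Pos n → A) : half₁ (join a b) = b := by
  funext s; simp [half₁, join]

theorem join_half {A : Type} {n : ℕ} (x : Pos (n + 1) → A) : join (half₀ x) (half₁ x) = x := by
  funext s
  rw [← Fin.cons_self_tail s]
  cases h : s 0 <;> simp [join, half₀, half₁]

/-- Blocks of length `2 ^ (n + 1)` are blocks of pairs of length `2 ^ n`. -/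
def pairEquiv (A : Type) (n : ℕ) : (Pos (n + 1) → A) ≃ (Pos n → A × A) where
  toFun x s := (half₀ x s, half₁ x s)
  invFun y := join (fun s => (y s).1) (fun s => (y s).2)
  left_inv x := join_half x
  right_inv y := by
    funext s
    simp only [half₀_join, half₁_join]

/-- Split a position into the first toss and the remaining ones. -/
theorem sum_pos_succ {n : ℕ} (f : Pos (n + 1) → ℝ) :
    ∑ s, f s = ∑ s, half₀ f s + ∑ s, half₁ f s := by
  rw [← (Fin.consEquiv fun _ : Fin (n + 1) => Bool).sum_comp, Fintype.sum_prod_type]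
  rw [Fintype.sum_bool, add_comm]
  rfl

theorem prod_pos_succ {n : ℕ} (f : Pos (n + 1) → ℝ) :
    ∏ s, f s = ∏ s, half₀ f s * half₁ f s := by
  rw [← (Fin.consEquiv fun _ : Fin (n + 1) => Bool).prod_comp, Fintype.prod_prod_type]
  rw [Fintype.prod_bool, mul_comm, Finset.prod_mul_distrib]
  rfl

/-- Combining the two halves of an erasure pattern letterwise. -/
theorem sum_comp_halves {n : ℕ} (z z' : ℝ) (op : Bool → Bool → Bool)
    (hop : ∀ b, (∑ a : Bool × Bool, if op a.1 a.2 = b then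
      erasureWeight z a.1 * erasureWeight z a.2 else 0) = erasureWeight z' b)
    (G : (Pos n → Bool) → ℝ) :
    ∑ e : Pos (n + 1) → Bool, G (fun s => op (half₀ e s) (half₁ e s)) *
      ∏ s, erasureWeight z (e s) = ∑ e, G e * ∏ s, erasureWeight z' (e s) := by
  have h := sum_comp_mul_prod (ι := Pos n) (fun a : Bool × Bool => op a.1 a.2)
    (fun _ a => erasureWeight z a.1 * erasureWeight z a.2) G
  simp_rw [hop] at h
  rw [← h, ← (pairEquiv Bool n).sum_comp]
  refine Finset.sum_congr rfl fun e _ => ?_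
  rw [prod_pos_succ]
  rfl

/-! ### Successive cancellation and the union bound -/

namespace PrunedTree

/-- Some utilized leaf channel is erased, when the decisions at all earlier leaves are correct. -/
def Fails : {n : ℕ} → PrunedTree n → (Pos n → Bool) → Prop
  | _, leaf b, e => b = true ∧ ∃ s, e s = true
  | _, node l r, e =>
      l.Fails (fun s => half₀ e s || half₁ e s) ∨ r.Fails (fun s => half₀ e s && half₁ e s)

/-- The block that is received when `x` is sent and the erasure pattern is `e`. -/
def received {n : ℕ} (x : Pos n → ZMod 2) (e : Pos n → Bool) (s : Pos n) : Option (ZMod 2) :=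
  if e s then none else some (x s)

/-- The sum of two received symbols is lost if either is erased; given the correct decision on a,
the symbol b is lost only if both are. Thus the children see received blocks with the "or" and the
"and" of the two half patterns, and induction applies to each. -/
theorem decodeAux_received {n : ℕ} (T : PrunedTree n) (u : Pos n → ZMod 2) (e : Pos n → Bool)
    (hu : ∀ s, T.utilized s = false → u s = 0) (he : ¬ T.Fails e) :
    T.decodeAux (received (T.transform u) e) =
      (fun s => some (u s), fun s => some (T.transform u s)) := by
  induction T with
  | leaf b =>
    cases b
    · have : u = fun _ => 0 := funext fun s => hu s rfl
      simp [decodeAux, transform, this]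
    · have h : ∀ s, e s = false := by simpa [Fails] using he
      have : received u e = fun s => some (u s) := by
        funext s; simp [received, h]
      simp [decodeAux, transform, this]
  | @node n l r ihl ihr =>
    simp only [Fails, not_or] at he
    have hl := ihl (half₀ u) (fun s => half₀ e s || half₁ e s)
      (fun s hs => hu _ (by simpa [utilized] using hs)) he.1
    have hr := ihr (half₁ u) (fun s => half₀ e s && half₁ e s)
      (fun s hs => hu _ (by simpa [utilized] using hs)) he.2
    set a := l.transform (half₀ u) with ha
    set b := r.transform (half₁ u) with hb
    have ht : (node l r).transform u = join (fun s => a s + b s) b := rfl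
    have e2 : ∀ x : ZMod 2, x + x = 0 := by decide
    have h0 : (fun s => Option.map₂ (· + ·) (half₀ (received (join (fun s => a s + b s) b) e) s)
        (half₁ (received (join (fun s => a s + b s) b) e) s)) =
        received a (fun s => half₀ e s || half₁ e s) := by
      funext s
      simp only [half₀, half₁, received, join, Fin.cons_zero, Fin.tail_cons]
      by_cases h₀ : e (Fin.cons false s) = true <;> by_cases h₁ : e (Fin.cons true s) = true <;>
        simp [h₀, h₁, add_assoc, e2]
    have h1 : (fun s => (half₁ (received (join (fun s => a s + b s) b) e) s).or
        (Option.map₂ (· + ·) (some (a s)) (half₀ (received (join (fun s => a s + b s) b) e) s))) =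
        received b (fun s => half₀ e s && half₁ e s) := by
      funext s
      simp only [half₀, half₁, received, join, Fin.cons_zero, Fin.tail_cons]
      by_cases h₀ : e (Fin.cons false s) = true <;> by_cases h₁ : e (Fin.cons true s) = true <;>
        simp [h₀, h₁, ← add_assoc, e2]
    rw [ht]
    simp only [decodeAux]
    rw [h0, hl]
    simp only
    rw [h1, hr]
    refine Prod.ext ?_ ?_
    · conv_rhs => rw [← join_half u]
      funext s
      cases h : s 0 <;> simp [join, h]
    · funext s
      cases h : s 0 <;> simp [join, h]

open Classical in
/-- The probability of `Fails` for independent erasures of probability `z`. -/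
noncomputable def failProb {n : ℕ} (T : PrunedTree n) (z : ℝ) : ℝ :=
  ∑ e, (if T.Fails e then 1 else 0) * ∏ s, erasureWeight z (e s)

theorem failProb_leaf_le {n : ℕ} {z : ℝ} (h0 : 0 ≤ z) (h1 : z ≤ 1) :
    (leaf true : PrunedTree n).failProb z ≤ 2 ^ n * z := by
  classical
  have hz := erasureWeight_nonneg h0 h1
  have hs : ∀ s : Pos n, ∑ e : Pos n → Bool, (if e s = true then (1 : ℝ) else 0) *
      ∏ s, erasureWeight z (e s) = z := by
    intro s
    -- The marginal at s comes from expanding a product of sums whose factor at s counts only an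
    -- erasure; all other factors sum to 1.
    have := Finset.prod_univ_sum (fun _ : Pos n => (Finset.univ : Finset Bool))
      (fun i a => if i = s then (if a = true then z else 0) else erasureWeight z a)
    rw [Fintype.piFinset_univ] at this
    rw [← Finset.mul_prod_erase _ _ (Finset.mem_univ s)] at this
    rw [Finset.prod_congr rfl (g := fun _ => (1 : ℝ))] at this
    · simp only [if_true, Finset.prod_const_one, mul_one, Fintype.sum_bool] at this
      simp only [Bool.false_eq_true, if_false, add_zero] at this
      refine Eq.trans (Finset.sum_congr rfl fun e _ => ?_) this.symm
      rw [← Finset.mul_prod_erase _ _ (Finset.mem_univ s),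
        ← Finset.mul_prod_erase _ (fun i => if i = s then (if e i = true then z else 0)
          else erasureWeight z (e i)) (Finset.mem_univ s), ← mul_assoc]
      congr 1
      · cases e s <;> simp [erasureWeight]
      · refine Finset.prod_congr rfl fun i hi => ?_
        rw [if_neg (Finset.ne_of_mem_erase hi)]
    · intro i hi
      simp only [if_neg (Finset.ne_of_mem_erase hi), sum_erasureWeight]
  calc (leaf true : PrunedTree n).failProb z
      ≤ ∑ e : Pos n → Bool, ∑ s, (if e s = true then (1 : ℝ) else 0) *
          ∏ s, erasureWeight z (e s) := by
        refine Finset.sum_le_sum fun e _ => ?_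
        rw [← Finset.sum_mul]
        refine mul_le_mul_of_nonneg_right ?_ (Finset.prod_nonneg fun s _ => hz _)
        split_ifs with h
        · obtain ⟨-, s, hs⟩ := h
          have := Finset.single_le_sum (f := fun s => if e s = true then (1 : ℝ) else 0)
            (fun i _ => by split_ifs <;> norm_num) (Finset.mem_univ s)
          simpa [hs] using this
        · exact Finset.sum_nonneg fun i _ => by split_ifs <;> norm_num
    _ = 2 ^ n * z := by
        rw [Finset.sum_comm]
        simp only [hs]
        simp

theorem failProb_leaf_false {n : ℕ} (z : ℝ) : (leaf false : PrunedTree n).failProb z = 0 := by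
  simp [failProb, Fails]

/-- The "or" and "and" patterns are each independent and identically distributed letterwise, with
parameters 2z - z² and z². They depend on each other, which the union bound tolerates. -/
theorem failProb_node_le {n : ℕ} (l r : PrunedTree n) {z : ℝ} (h0 : 0 ≤ z) (h1 : z ≤ 1) :
    (node l r).failProb z ≤ l.failProb (2 * z - z ^ 2) + r.failProb (z ^ 2) := by
  classical
  have hz := erasureWeight_nonneg h0 h1
  unfold failProb
  rw [← sum_comp_halves z (2 * z - z ^ 2) (· || ·), ← sum_comp_halves z (z ^ 2) (· && ·),
    ← Finset.sum_add_distrib]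
  · refine Finset.sum_le_sum fun e _ => ?_
    rw [← add_mul]
    refine mul_le_mul_of_nonneg_right ?_ (Finset.prod_nonneg fun s _ => hz _)
    by_cases hl : l.Fails (fun s => half₀ e s || half₁ e s) <;>
      by_cases hr : r.Fails (fun s => half₀ e s && half₁ e s) <;>
      simp [Fails, hl, hr]
  · intro b; cases b <;> simp [Fintype.sum_prod_type, erasureWeight] <;> ring
  · intro b; cases b <;> simp [Fintype.sum_prod_type, erasureWeight] <;> ring

theorem failProb_growBEC_le {θ : ℝ} (k : ℕ) {z : ℝ} (h0 : 0 ≤ z) (h1 : z ≤ 1) (hθ : 0 ≤ θ) :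
    (growBEC θ k z).failProb z ≤ 2 ^ k * θ := by
  have hleaf : ∀ {n : ℕ} {z : ℝ}, 0 ≤ z → z ≤ 1 →
      (leaf (decide (z ≤ θ)) : PrunedTree n).failProb z ≤ 2 ^ n * θ := by
    intro n z h0 h1
    by_cases h : z ≤ θ
    · rw [decide_eq_true h]
      exact (failProb_leaf_le h0 h1).trans (by gcongr)
    · rw [decide_eq_false h, failProb_leaf_false]
      positivity
  induction k generalizing z with
  | zero => exact hleaf h0 h1
  | succ k ih =>
    rw [growBEC]
    split_ifs
    · refine (failProb_node_le _ _ h0 h1).trans ?_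
      have hf := ih (z := 2 * z - z ^ 2) (by nlinarith) (by nlinarith [sq_nonneg (1 - z)])
      have hs := ih (z := z ^ 2) (by positivity) (by nlinarith)
      linarith [show (2 : ℝ) ^ (k + 1) * θ = 2 ^ k * θ + 2 ^ k * θ by ring]
    · exact hleaf h0 h1

/-- The bound is uniform in the message because the erasure pattern has the same law whatever
codeword is sent. -/
theorem errorProb_le_failProb {n : ℕ} (T : PrunedTree n) (p : ℝ) (h0 : 0 ≤ p) (h1 : p ≤ 1)
    (m : T.InfoPos → ZMod 2) : T.errorProb p h0 h1 m ≤ T.failProb p := by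
  classical
  set u : Pos n → ZMod 2 := fun s => if h : T.utilized s = true then m ⟨s, h⟩ else 0 with hu
  have hx : T.encode m = T.transform u := rfl
  set x := T.transform u
  have hw : ∀ s (b : Bool), (∑ a : Option (ZMod 2), if a.isNone = b then
      (bec p h0 h1).prob (x s) a else 0) = erasureWeight p b := by
    intro s b
    change (∑ a : Option (ZMod 2), if a.isNone = b then becProb p (x s) a else 0) = _
    cases b <;> simp [Fintype.sum_option, becProb, erasureWeight]
  have h := sum_comp_mul_prod (fun a : Option (ZMod 2) => a.isNone)
    (fun s a => (bec p h0 h1).prob (x s) a) (fun e => if T.Fails e then 1 else 0)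
  simp_rw [hw] at h
  rw [errorProb, failProb, ← h, hx]
  refine Finset.sum_le_sum fun y _ => ?_
  have hnn : 0 ≤ ∏ s, (bec p h0 h1).prob (x s) (y s) :=
    Finset.prod_nonneg fun s _ => (bec p h0 h1).prob_nonneg _ _
  by_cases hF : T.Fails fun s => (y s).isNone
  · rw [if_pos hF, one_mul]
    split_ifs
    · exact hnn
    · exact le_rfl
  rw [if_neg hF, zero_mul]
  -- An output that is not the codeword with some symbols erased has probability zero.
  by_cases hy : y = received x fun s => (y s).isNone
  · rw [if_pos]
    have := decodeAux_received T u _ (fun s hs => by simp [hu, hs]) hF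
    funext i
    rw [decode, hy, this]
    simp [hu, i.2]
  · obtain ⟨s, hs⟩ := Function.ne_iff.1 hy
    rw [Finset.prod_eq_zero (Finset.mem_univ s)]
    · simp
    · change becProb p (x s) (y s) = 0
      rcases h : y s with _ | a
      · simp [received, h] at hs
      · have : a ≠ x s := by simpa [received, h] using hs
        simp [becProb, this]

end PrunedTree

/-! ### Counting gates -/

theorem StraightLine.gates {κ A ι : Type} [Fintype ι] (op : A → A → A) {t : ℕ}
    {S : Set ((κ → A) → A)} (hS : StraightLine t S) (f g : ι → (κ → A) → A)
    (hf : ∀ i, f i ∈ S) (hg : ∀ i, g i ∈ S) :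
    ∃ S', S ⊆ S' ∧ StraightLine (t + Fintype.card ι) S' ∧
      ∀ i, (fun x => op (f i x) (g i x)) ∈ S' := by
  classical
  have : ∀ I : Finset ι, ∃ S', S ⊆ S' ∧ StraightLine (t + I.card) S' ∧
      ∀ i ∈ I, (fun x => op (f i x) (g i x)) ∈ S' := by
    intro I
    induction I using Finset.induction_on with
    | empty => exact ⟨S, subset_rfl, by simpa using hS, by simp⟩
    | insert a I ha ih =>
      obtain ⟨S', h1, h2, h3⟩ := ih
      refine ⟨insert (fun x => op (f a x) (g a x)) S', h1.trans (Set.subset_insert _ _), ?_, ?_⟩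
      · rw [Finset.card_insert_of_notMem ha, ← add_assoc]
        exact StraightLine.gate op (f a) (g a) h2 (h1 (hf a)) (h1 (hg a))
      · intro i hi
        rcases Finset.mem_insert.1 hi with rfl | hi
        · exact Set.mem_insert _ _
        · exact Set.mem_insert_of_mem _ (h3 i hi)
  obtain ⟨S', h1, h2, h3⟩ := this Finset.univ
  exact ⟨S', h1, h2, fun i => h3 i (Finset.mem_univ i)⟩

theorem join_mem {A B : Type} {n : ℕ} {S : Set (B → A)} {f g : Pos n → B → A}
    (hf : ∀ s, f s ∈ S) (hg : ∀ s, g s ∈ S) (s : Pos (n + 1)) :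
    (fun x => join (fun s => f s x) (fun s => g s x) s) ∈ S := by
  cases h : s 0
  · simpa [join, h] using hf (Fin.tail s)
  · simpa [join, h] using hg (Fin.tail s)

namespace PrunedTree

/-- The number of butterfly devices of the circuit. -/
def butterflies : {n : ℕ} → PrunedTree n → ℕ
  | _, leaf _ => 0
  | _, @node n l r => l.butterflies + r.butterflies + 2 ^ n

/-- Each butterfly joins two wires, and the wire of a leaf at depth d passes through d butterflies.
-/
theorem two_mul_butterflies {n : ℕ} (T : PrunedTree n) :
    2 * (T.butterflies : ℝ) = ∑ s, (T.stopTime s : ℝ) := by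
  induction T with
  | leaf => simp [butterflies, stopTime]
  | @node n l r ihl ihr =>
    rw [sum_pos_succ]
    simp only [half₀, half₁, stopTime, butterflies, Fin.cons_zero, Fin.tail_cons]
    push_cast
    simp only [Finset.sum_add_distrib, ← ihl, ← ihr]
    simp
    ring

theorem straightLine_transform {n : ℕ} (T : PrunedTree n) {κ : Type} {t : ℕ}
    {S : Set ((κ → ZMod 2) → ZMod 2)} (hS : StraightLine t S)
    (u : Pos n → (κ → ZMod 2) → ZMod 2) (hu : ∀ s, u s ∈ S) :
    ∃ S', S ⊆ S' ∧ StraightLine (t + T.butterflies) S' ∧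
      ∀ s, (fun x => T.transform (fun s => u s x) s) ∈ S' := by
  induction T generalizing t S with
  | leaf b => exact ⟨S, subset_rfl, by simpa [butterflies] using hS, hu⟩
  | @node n l r ihl ihr =>
    obtain ⟨S₁, h1, h2, h3⟩ := ihl hS (half₀ u) fun s => hu _
    obtain ⟨S₂, k1, k2, k3⟩ := ihr h2 (half₁ u) fun s => h1 (hu _)
    obtain ⟨S₃, l1, l2, l3⟩ := k2.gates (· + ·) _ _ (fun s => k1 (h3 s)) k3
    refine ⟨S₃, h1.trans (k1.trans l1), ?_, ?_⟩
    · convert l2 using 1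
      simp [butterflies]
      ring
    · exact join_mem l3 fun s => l1 (k3 s)

theorem computableIn_encode {n : ℕ} (T : PrunedTree n) :
    ComputableIn T.encode (T.butterflies + 1) := by
  obtain ⟨S, h1, h2, h3⟩ := T.straightLine_transform
    -- A single constant gate serves all frozen positions; it is the `+ 1` in the bound.
    (StraightLine.const 0 (StraightLine.input (κ := T.InfoPos)))
    (fun s m => if h : T.utilized s = true then m ⟨s, h⟩ else 0) (by
      intro s
      by_cases h : T.utilized s = true
      · exact Set.mem_insert_of_mem _ ⟨⟨s, h⟩, by simp [h]⟩
      · simp [h])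
  exact ⟨_, S, h2, h3, by push_cast; linarith⟩

/-- Four gates per butterfly: the sum passed to the `♭` side, the sum of its decision with y₀, the
choice between that and y₁, and the recombination a + b. -/
theorem straightLine_decodeAux {n : ℕ} (T : PrunedTree n) {κ : Type} {t : ℕ}
    {S : Set ((κ → Option (ZMod 2)) → Option (ZMod 2))} (hS : StraightLine t S)
    (h0 : (fun _ => some 0) ∈ S)
    (y : Pos n → (κ → Option (ZMod 2)) → Option (ZMod 2)) (hy : ∀ s, y s ∈ S) :
    ∃ S', S ⊆ S' ∧ StraightLine (t + 4 * T.butterflies) S' ∧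
      (∀ s, (fun x => (T.decodeAux (fun s => y s x)).1 s) ∈ S') ∧
      ∀ s, (fun x => (T.decodeAux (fun s => y s x)).2 s) ∈ S' := by
  induction T generalizing t S with
  | leaf b =>
    refine ⟨S, subset_rfl, by simpa [butterflies] using hS, ?_⟩
    cases b
    · exact ⟨fun s => h0, fun s => h0⟩
    · exact ⟨hy, hy⟩
  | @node n l r ihl ihr =>
    obtain ⟨S₁, a1, a2, a3⟩ := hS.gates (Option.map₂ (· + ·)) (half₀ y) (half₁ y)
      (fun s => hy _) (fun s => hy _)
    obtain ⟨S₂, b1, b2, b3, b4⟩ := ihl a2 (a1 h0) _ a3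
    have hb := a1.trans b1
    obtain ⟨S₃, c1, c2, c3⟩ := b2.gates (Option.map₂ (· + ·)) _ (half₀ y) b4 (fun s => hb (hy _))
    have hc := hb.trans c1
    obtain ⟨S₄, d1, d2, d3⟩ := c2.gates Option.or (half₁ y) _ (fun s => hc (hy _)) c3
    have hd := hc.trans d1
    obtain ⟨S₅, e1, e2, e3, e4⟩ := ihr d2 (hd h0) _ d3
    obtain ⟨S₆, f1, f2, f3⟩ := e2.gates (Option.map₂ (· + ·)) _ _
      (fun s => e1 (d1 (c1 (b4 s)))) e4
    refine ⟨S₆, hd.trans (e1.trans f1), ?_, ?_, ?_⟩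
    · convert f2 using 1
      simp [butterflies]
      ring
    · exact join_mem (fun s => f1 (e1 (d1 (c1 (b3 s))))) fun s => f1 (e3 s)
    · exact join_mem f3 fun s => f1 (e4 s)

theorem computableIn_decode {n : ℕ} (T : PrunedTree n) :
    ComputableIn T.decode (4 * T.butterflies + 1) := by
  obtain ⟨S, h1, h2, h3, -⟩ := T.straightLine_decodeAux
    (StraightLine.const (some 0) (StraightLine.input (κ := Pos n))) (Set.mem_insert _ _)
    (fun s y => y s) (fun s => Set.mem_insert_of_mem _ ⟨s, rfl⟩)
  exact ⟨_, S, h2, fun i => h3 i.1, by push_cast; linarith⟩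

end PrunedTree

/-! ### Decay of the polarization potential -/

/-- The variance of an erasure with probability `z`. -/
noncomputable def erasureVar (z : ℝ) : ℝ := z * (1 - z)

theorem erasureVar_nonneg {z : ℝ} (h0 : 0 ≤ z) (h1 : z ≤ 1) : 0 ≤ erasureVar z :=
  mul_nonneg h0 (sub_nonneg.2 h1)

theorem erasureVar_pos {z : ℝ} (h0 : 0 < z) (h1 : z < 1) : 0 < erasureVar z :=
  mul_pos h0 (sub_pos.2 h1)

theorem erasureVar_le (z : ℝ) : erasureVar z ≤ 1 / 4 := by
  unfold erasureVar; nlinarith [sq_nonneg (z - 1 / 2)]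

theorem erasureVar_flat (z : ℝ) :
    erasureVar (2 * z - z ^ 2) = erasureVar z * ((2 - z) * (1 - z)) := by
  unfold erasureVar; ring

theorem erasureVar_sharp (z : ℝ) : erasureVar (z ^ 2) = erasureVar z * (z * (1 + z)) := by
  unfold erasureVar; ring

theorem flat_mem_Icc {z : ℝ} (h0 : 0 ≤ z) (h1 : z ≤ 1) :
    0 ≤ 2 * z - z ^ 2 ∧ 2 * z - z ^ 2 ≤ 1 :=
  ⟨by nlinarith, by nlinarith [sq_nonneg (1 - z)]⟩

theorem sharp_mem_Icc {z : ℝ} (h0 : 0 ≤ z) (h1 : z ≤ 1) : 0 ≤ z ^ 2 ∧ z ^ 2 ≤ 1 :=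
  ⟨by positivity, by nlinarith⟩

/-- One child at most doubles the variance and the other child squares it, up to a constant. -/
theorem erasureVar_children {z : ℝ} (h0 : 0 ≤ z) (h1 : z ≤ 1) :
    (erasureVar (2 * z - z ^ 2) ≤ 2 * erasureVar z ∧
      erasureVar (z ^ 2) ≤ 3 * erasureVar z ^ 2) ∨
    (erasureVar (z ^ 2) ≤ 2 * erasureVar z ∧
      erasureVar (2 * z - z ^ 2) ≤ 3 * erasureVar z ^ 2) := by
  have hq := erasureVar_nonneg h0 h1
  rw [erasureVar_flat, erasureVar_sharp]
  have e : 3 * erasureVar z ^ 2 = erasureVar z * (3 * (z * (1 - z))) := by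
    unfold erasureVar; ring
  rw [e, mul_comm 2]
  rcases le_total z (1 / 2) with h | h
  · left
    constructor <;> apply mul_le_mul_of_nonneg_left _ hq <;> nlinarith
  · right
    constructor <;> apply mul_le_mul_of_nonneg_left _ hq <;> nlinarith

/-- With A = (2 - z)(1 - z), B = z(1 + z) and q = z(1 - z), one has A + B = 2 - 2q and AB = q² + 2q
≤ (1/2 + q)², the latter since q ≤ 1/4. Hence (√A + √B)² ≤ 3, with equality at z = 1/2. -/
theorem sqrt_erasureVar_children {z : ℝ} (h0 : 0 ≤ z) (h1 : z ≤ 1) :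
    √(erasureVar (2 * z - z ^ 2)) + √(erasureVar (z ^ 2)) ≤ √3 * √(erasureVar z) := by
  have hq := erasureVar_nonneg h0 h1
  have hq4 := erasureVar_le z
  rw [erasureVar_flat, erasureVar_sharp, Real.sqrt_mul hq, Real.sqrt_mul hq, ← mul_add, mul_comm]
  refine mul_le_mul_of_nonneg_right ?_ (Real.sqrt_nonneg _)
  have hA : 0 ≤ (2 - z) * (1 - z) := by nlinarith
  have hB : 0 ≤ z * (1 + z) := by positivity
  apply Real.le_sqrt_of_sq_le
  have hab : √((2 - z) * (1 - z)) * √(z * (1 + z)) ≤ 1 / 2 + erasureVar z := by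
    rw [← Real.sqrt_mul hA]
    apply Real.sqrt_le_iff.2 ⟨by linarith, ?_⟩
    have : (2 - z) * (1 - z) * (z * (1 + z)) = erasureVar z ^ 2 + 2 * erasureVar z := by
      unfold erasureVar; ring
    nlinarith
  rw [add_sq, Real.sq_sqrt hA, Real.sq_sqrt hB]
  unfold erasureVar at hab
  nlinarith

/-- The rate of decay of `polarization`. -/
noncomputable def decayRate : ℝ := 2 ^ (-(6 / 29) : ℝ)

/-- This amounts to 3^29 < 2^46. The exponent 6/29 still exceeds 1/5, so that n ≥ 5 log₂(1/ε) steps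
yield a power of ε above 1. -/
theorem sqrt_three_lt_decayRate : √3 / 2 < decayRate := by
  have h : √3 < 2 ^ (23 / 29 : ℝ) := by
    rw [Real.sqrt_lt' (by positivity), ← Real.rpow_natCast, ← Real.rpow_mul (by norm_num)]
    apply lt_of_pow_lt_pow_left₀ 29 (by positivity)
    rw [← Real.rpow_natCast (2 ^ _), ← Real.rpow_mul (by norm_num)]
    norm_num
  have : decayRate = 2 ^ (23 / 29 : ℝ) / 2 := by
    rw [decayRate, show (-(6 / 29) : ℝ) = 23 / 29 - 1 by norm_num,
      Real.rpow_sub (by norm_num), Real.rpow_one]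
  rw [this]
  linarith

/-- The constant that separates the polarized from the unpolarized regime. -/
noncomputable def smallVar : ℝ := (1 / 2) ^ 200 / 3

/-- The weight of the second term of `polarization`. -/
noncomputable def polarizationWeight : ℝ := (decayRate - √3 / 2) * √smallVar

theorem polarizationWeight_pos : 0 < polarizationWeight :=
  mul_pos (sub_pos.2 sqrt_three_lt_decayRate) (Real.sqrt_pos.2 (by unfold smallVar; positivity))

/-- A potential that contracts at rate `decayRate` under Arıkan's transform and vanishes only
slowly at the endpoints. -/
noncomputable def polarization (z : ℝ) : ℝ :=
  √(erasureVar z) + polarizationWeight * erasureVar z ^ (1 / 200 : ℝ)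

theorem polarization_nonneg {z : ℝ} (h0 : 0 ≤ z) (h1 : z ≤ 1) : 0 ≤ polarization z :=
  add_nonneg (Real.sqrt_nonneg _) (mul_nonneg polarizationWeight_pos.le
    (Real.rpow_nonneg (erasureVar_nonneg h0 h1) _))

theorem rpow_erasureVar_children {z : ℝ} (h0 : 0 ≤ z) (h1 : z ≤ 1)
    (hz : erasureVar z ≤ smallVar) :
    erasureVar (2 * z - z ^ 2) ^ (1 / 200 : ℝ) + erasureVar (z ^ 2) ^ (1 / 200 : ℝ) ≤
      2 * decayRate * erasureVar z ^ (1 / 200 : ℝ) := by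
  have hq := erasureVar_nonneg h0 h1
  have hf := erasureVar_nonneg (flat_mem_Icc h0 h1).1 (flat_mem_Icc h0 h1).2
  have hs := erasureVar_nonneg (sharp_mem_Icc h0 h1).1 (sharp_mem_Icc h0 h1).2
  have h17 : (17 / 10 : ℝ) ≤ √3 := Real.le_sqrt_of_sq_le (by norm_num)
  have hd := sqrt_three_lt_decayRate
  -- The two children contribute factors of at most 11/10 and 1/2, in total below 17/10 ≤ √3.
  have two : (2 : ℝ) ^ (1 / 200 : ℝ) ≤ 11 / 10 := by
    apply le_of_pow_le_pow_left₀ (n := 200) (by norm_num) (by norm_num)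
    rw [← Real.rpow_natCast (2 ^ _), ← Real.rpow_mul (by norm_num)]
    norm_num
  have small : (3 * erasureVar z) ^ (1 / 200 : ℝ) ≤ 1 / 2 := by
    calc (3 * erasureVar z) ^ (1 / 200 : ℝ) ≤ ((1 / 2) ^ 200) ^ (1 / 200 : ℝ) := by
          apply Real.rpow_le_rpow (by positivity) _ (by norm_num)
          unfold smallVar at hz
          linarith
      _ = 1 / 2 := by
          rw [← Real.rpow_natCast (1 / 2), ← Real.rpow_mul (by norm_num)]
          norm_num
  have key : ∀ {a b : ℝ}, 0 ≤ a → 0 ≤ b → a ≤ 2 * erasureVar z → b ≤ 3 * erasureVar z ^ 2 →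
      a ^ (1 / 200 : ℝ) + b ^ (1 / 200 : ℝ) ≤ 2 * decayRate * erasureVar z ^ (1 / 200 : ℝ) := by
    intro a b ha hb ha' hb'
    have h1 : a ^ (1 / 200 : ℝ) ≤ 2 ^ (1 / 200 : ℝ) * erasureVar z ^ (1 / 200 : ℝ) := by
      rw [← Real.mul_rpow (by norm_num) hq]
      exact Real.rpow_le_rpow ha ha' (by norm_num)
    have h2 : b ^ (1 / 200 : ℝ) ≤
        (3 * erasureVar z) ^ (1 / 200 : ℝ) * erasureVar z ^ (1 / 200 : ℝ) := by
      rw [← Real.mul_rpow (by positivity) hq]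
      exact Real.rpow_le_rpow hb (by linarith [sq (erasureVar z)]) (by norm_num)
    nlinarith [Real.rpow_nonneg hq (1 / 200 : ℝ)]
  rcases erasureVar_children h0 h1 with ⟨h, h'⟩ | ⟨h, h'⟩
  · exact key hf hs h h'
  · rw [add_comm]
    exact key hs hf h h'

/-- For small q both terms contract separately. Otherwise the second term may grow, but its children
total at most 2 `polarizationWeight`, which the slack (2 `decayRate` - √3)√q of the first term
absorbs. -/
theorem polarization_children {z : ℝ} (h0 : 0 ≤ z) (h1 : z ≤ 1) :
    polarization (2 * z - z ^ 2) + polarization (z ^ 2) ≤ 2 * decayRate * polarization z := by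
  have hq := erasureVar_nonneg h0 h1
  have hf := erasureVar_nonneg (flat_mem_Icc h0 h1).1 (flat_mem_Icc h0 h1).2
  have hs := erasureVar_nonneg (sharp_mem_Icc h0 h1).1 (sharp_mem_Icc h0 h1).2
  have hsq := sqrt_erasureVar_children h0 h1
  have hd := sqrt_three_lt_decayRate
  have hc := polarizationWeight_pos
  have hd0 : 0 < decayRate := by unfold decayRate; positivity
  have hsn := Real.sqrt_nonneg (erasureVar z)
  have hrn := Real.rpow_nonneg hq (1 / 200 : ℝ)
  unfold polarization
  rcases le_total (erasureVar z) smallVar with h | h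
  · have := rpow_erasureVar_children h0 h1 h
    nlinarith
  · have le_one : ∀ {a : ℝ}, 0 ≤ a → a ≤ 1 / 4 → a ^ (1 / 200 : ℝ) ≤ 1 := fun ha ha' =>
      Real.rpow_le_one ha (by linarith) (by norm_num)
    have ha := le_one hf (erasureVar_le _)
    have hb := le_one hs (erasureVar_le _)
    have hw : polarizationWeight ≤ (decayRate - √3 / 2) * √(erasureVar z) :=
      mul_le_mul_of_nonneg_left (Real.sqrt_le_sqrt h) (sub_pos.2 hd).le
    have h3 : 0 ≤ 2 * decayRate * (polarizationWeight * erasureVar z ^ (1 / 200 : ℝ)) := by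
      positivity
    have h4 := mul_le_mul_of_nonneg_left (add_le_add ha hb) hc.le
    nlinarith

/-! ### Drift of the log-log potential -/

/-- A potential that has a positive drift until it reaches the endpoints. -/
noncomputable def logLogVar (z : ℝ) : ℝ :=
  Real.log (-Real.log (erasureVar z)) - 40 * √(erasureVar z)

theorem log_four_le {x : ℝ} (h0 : 0 < x) (h : x ≤ 1 / 4) : 2 * Real.log 2 ≤ -Real.log x := by
  have h1 := Real.log_le_log h0 h
  rw [show (1 / 4 : ℝ) = (2 ^ 2)⁻¹ by norm_num, Real.log_inv, Real.log_pow] at h1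
  push_cast at h1
  linarith

/-- For -log q ≥ 4 the iterated logarithm itself gains 1/4 over the two children. Otherwise it loses
at most 1, while √q ≥ 1/8 and the correction term gains 40(2 - √3)√q ≥ 1.3. -/
theorem logLogVar_drift {z : ℝ} (h0 : 0 < z) (h1 : z < 1) :
    2 * logLogVar z + 1 / 4 ≤ logLogVar (2 * z - z ^ 2) + logLogVar (z ^ 2) := by
  have hq := erasureVar_pos h0 h1
  have hf : 0 < erasureVar (2 * z - z ^ 2) := by
    rw [erasureVar_flat]
    exact mul_pos hq (mul_pos (by linarith) (by linarith))
  have hs : 0 < erasureVar (z ^ 2) := by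
    rw [erasureVar_sharp]
    exact mul_pos hq (by positivity)
  have hsq := sqrt_erasureVar_children h0.le h1.le
  have l2 := Real.log_two_gt_d9
  have l2' := Real.log_two_lt_d9
  have l3 : Real.log 3 < 2 * Real.log 2 := by
    rw [← Real.log_rpow (by norm_num)]
    exact Real.log_lt_log (by norm_num) (by norm_num)
  have key : ∀ {a b : ℝ}, 0 < a → 0 < b → a ≤ 2 * erasureVar z → b ≤ 3 * erasureVar z ^ 2 →
      2 * Real.log (-Real.log (erasureVar z)) - 1 ≤
        Real.log (-Real.log a) + Real.log (-Real.log b) ∧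
      (4 ≤ -Real.log (erasureVar z) → 2 * Real.log (-Real.log (erasureVar z)) + 1 / 4 ≤
        Real.log (-Real.log a) + Real.log (-Real.log b)) := by
    intro a b ha hb ha' hb'
    have hl := log_four_le hq (erasureVar_le z)
    have hla := Real.log_le_log ha ha'
    rw [Real.log_mul (by norm_num) hq.ne'] at hla
    have hlb := Real.log_le_log hb hb'
    rw [Real.log_mul (by norm_num) (by positivity), Real.log_pow] at hlb
    push_cast at hlb
    set l := -Real.log (erasureVar z)
    have hx : l / 2 ≤ -Real.log a := by linarith
    have hy : l ≤ -Real.log b := by linarith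
    have hl0 : 0 < l := by linarith
    rw [← Real.log_mul (by linarith) (by linarith)]
    have e : 2 * Real.log l = Real.log (l ^ 2) := by rw [Real.log_pow]; push_cast; ring
    rw [e]
    constructor
    · have : Real.log (l ^ 2 / 2) ≤ Real.log (-Real.log a * -Real.log b) :=
        Real.log_le_log (by positivity) (by nlinarith)
      rw [Real.log_div (by positivity) (by norm_num)] at this
      linarith
    · intro h4
      have : Real.log (l ^ 2 * (27 / 20)) ≤ Real.log (-Real.log a * -Real.log b) := by
        apply Real.log_le_log (by positivity)
        -- As l ≥ 4, subtracting log 2 or log 3 costs at most 7/40 or 14/40 of l. The product of the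
        -- factors exceeds 27/20, whose logarithm is at least 7/27 > 1/4.
        have h1 : 33 / 40 * l ≤ -Real.log a := by linarith
        have h2 : 66 / 40 * l ≤ -Real.log b := by linarith
        nlinarith [mul_le_mul h1 h2 (by positivity) (by linarith)]
      rw [Real.log_mul (by positivity) (by norm_num)] at this
      have := Real.one_sub_inv_le_log_of_pos (show (0 : ℝ) < 27 / 20 by norm_num)
      norm_num at this
      linarith
  have key' : 2 * Real.log (-Real.log (erasureVar z)) - 1 ≤
        Real.log (-Real.log (erasureVar (2 * z - z ^ 2))) +
          Real.log (-Real.log (erasureVar (z ^ 2))) ∧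
      (4 ≤ -Real.log (erasureVar z) → 2 * Real.log (-Real.log (erasureVar z)) + 1 / 4 ≤
        Real.log (-Real.log (erasureVar (2 * z - z ^ 2))) +
          Real.log (-Real.log (erasureVar (z ^ 2)))) := by
    rcases erasureVar_children h0.le h1.le with ⟨h, h'⟩ | ⟨h, h'⟩
    · exact key hf hs h h'
    · rw [add_comm (Real.log (-Real.log (erasureVar (2 * z - z ^ 2))))]
      exact key hs hf h h'
  have h3 : √3 ≤ 174 / 100 := Real.sqrt_le_iff.2 ⟨by norm_num, by norm_num⟩
  have hn := Real.sqrt_nonneg (erasureVar z)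
  unfold logLogVar
  by_cases h4 : 4 ≤ -Real.log (erasureVar z)
  · have := key'.2 h4
    nlinarith
  · have h8 : 1 / 8 ≤ √(erasureVar z) := by
      apply Real.le_sqrt_of_sq_le
      have hlt : -4 < Real.log (erasureVar z) := by linarith
      have hexp := (Real.lt_log_iff_exp_lt hq).1 hlt
      have he : Real.exp 4 ≤ 64 := by
        have := Real.exp_one_lt_d9
        rw [show (4 : ℝ) = ((4 : ℕ) : ℝ) * 1 by norm_num, Real.exp_nat_mul]
        calc Real.exp 1 ^ 4 ≤ (2.8 : ℝ) ^ 4 := by gcongr; linarith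
          _ ≤ 64 := by norm_num
      rw [Real.exp_neg] at hexp
      have : (64 : ℝ)⁻¹ ≤ (Real.exp 4)⁻¹ := inv_anti₀ (Real.exp_pos _) he
      norm_num at this ⊢
      linarith
    have := key'.1
    nlinarith

/-! ### Rate, stopping time and depth of the tree -/

namespace PrunedTree

theorem dimension_eq_sum {n : ℕ} (T : PrunedTree n) :
    (T.dimension : ℝ) = ∑ s, if T.utilized s = true then 1 else 0 := by
  rw [dimension, Fintype.card_subtype, Finset.sum_boole]

theorem blockLength_eq {n : ℕ} (T : PrunedTree n) : T.blockLength = 2 ^ n := by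
  simp [blockLength]

theorem rate_node {n : ℕ} (l r : PrunedTree n) :
    (node l r).rate = (l.rate + r.rate) / 2 := by
  simp only [rate, blockLength_eq, dimension_eq_sum, sum_pos_succ]
  simp only [half₀, half₁, utilized, Fin.cons_zero, Fin.tail_cons]
  push_cast
  field_simp
  ring

theorem rate_leaf_true {n : ℕ} : (leaf true : PrunedTree n).rate = 1 := by
  simp [rate, blockLength_eq, dimension_eq_sum, utilized]

theorem rate_nonneg {n : ℕ} (T : PrunedTree n) : 0 ≤ T.rate := by
  unfold rate; positivity

theorem expectedStopTime_node {n : ℕ} (l r : PrunedTree n) :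
    (node l r).expectedStopTime = (l.expectedStopTime + r.expectedStopTime) / 2 + 1 := by
  simp only [expectedStopTime, sum_pos_succ]
  simp only [half₀, half₁, stopTime, Fin.cons_zero, Fin.tail_cons]
  push_cast
  simp only [Finset.sum_add_distrib]
  simp
  field_simp
  ring

theorem expectedStopTime_leaf {n : ℕ} (b : Bool) :
    (leaf b : PrunedTree n).expectedStopTime = 0 := by
  simp [expectedStopTime, stopTime]

end PrunedTree

open PrunedTree

/-- The term 1 - z averages exactly over the children and the potential contracts, so only leaves
need checking. A leaf with 1 - z ≤ θ costs at most θ; an unpolarized leaf occurs only at `k = 0`,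
where polarization/δ ≥ 1 pays for it. -/
theorem le_rate_growBEC {θ δ : ℝ} (hθ : 0 ≤ θ) (hδ : 0 < δ)
    (h : ∀ z, θ < z → θ < 1 - z → δ ≤ polarization z) (k : ℕ) {z : ℝ} (h0 : 0 ≤ z) (h1 : z ≤ 1) :
    1 - z - θ - polarization z * decayRate ^ k / δ ≤ (growBEC θ k z).rate := by
  have hd0 : 0 < decayRate := by unfold decayRate; positivity
  have hleaf : ∀ {n : ℕ} (k : ℕ) {z : ℝ}, 0 ≤ z → z ≤ 1 → (k = 0 ∨ min z (1 - z) ≤ θ) →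
      1 - z - θ - polarization z * decayRate ^ k / δ ≤
        (leaf (decide (z ≤ θ)) : PrunedTree n).rate := by
    intro n k z h0 h1 hz
    have hp : 0 ≤ polarization z * decayRate ^ k / δ :=
      div_nonneg (mul_nonneg (polarization_nonneg h0 h1) (by positivity)) hδ.le
    by_cases hzθ : z ≤ θ
    · rw [decide_eq_true hzθ, rate_leaf_true]
      linarith
    refine le_trans ?_ (rate_nonneg _)
    by_cases hzθ' : 1 - z ≤ θ
    · linarith
    rcases hz with rfl | hz
    · have := (one_le_div hδ).2 (h z (not_le.1 hzθ) (not_le.1 hzθ'))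
      rw [pow_zero, mul_one]
      linarith
    · rcases min_le_iff.1 hz with hz | hz <;> contradiction
  induction k generalizing z with
  | zero => exact hleaf 0 h0 h1 (Or.inl rfl)
  | succ k ih =>
    rw [growBEC]
    split_ifs with hz
    · have hf := ih (flat_mem_Icc h0 h1).1 (flat_mem_Icc h0 h1).2
      have hs := ih (sharp_mem_Icc h0 h1).1 (sharp_mem_Icc h0 h1).2
      have hc : (polarization (2 * z - z ^ 2) + polarization (z ^ 2)) * (decayRate ^ k / δ) ≤
          2 * decayRate * polarization z * (decayRate ^ k / δ) :=
        mul_le_mul_of_nonneg_right (polarization_children h0 h1) (by positivity)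
      rw [rate_node]
      have e : 2 * decayRate * polarization z * (decayRate ^ k / δ) =
          2 * (polarization z * decayRate ^ (k + 1) / δ) := by ring
      have e' : (polarization (2 * z - z ^ 2) + polarization (z ^ 2)) * (decayRate ^ k / δ) =
          polarization (2 * z - z ^ 2) * decayRate ^ k / δ +
            polarization (z ^ 2) * decayRate ^ k / δ := by ring
      linarith
    · exact hleaf _ h0 h1 (Or.inr (not_lt.1 hz))

theorem logLogVar_le {z x : ℝ} (hx : 0 < x) (hz : x ≤ erasureVar z) :
    logLogVar z ≤ Real.log (-Real.log x) := by
  have h4 := log_four_le (hx.trans_le hz) (erasureVar_le z)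
  have hl := Real.log_le_log hx hz
  have := Real.log_le_log (by linarith [Real.log_two_gt_d9]) (neg_le_neg hl)
  unfold logLogVar
  linarith [Real.sqrt_nonneg (erasureVar z)]

/-- Optional stopping for a drift of 1/8 per step. A vertex that is split has q ≥ θ/2, and each
child multiplies q by at least θ; so θ²/2 bounds q from below even at leaves past the threshold. -/
theorem expectedStopTime_growBEC_le {θ : ℝ} (hθ : 0 < θ) (k : ℕ) {z : ℝ} (h0 : 0 < z) (h1 : z < 1)
    (hz : θ ^ 2 / 2 ≤ erasureVar z) :
    (growBEC θ k z).expectedStopTime ≤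
      8 * (Real.log (-Real.log (θ ^ 2 / 2)) - logLogVar z) := by
  have hleaf : ∀ {z : ℝ}, θ ^ 2 / 2 ≤ erasureVar z →
      0 ≤ 8 * (Real.log (-Real.log (θ ^ 2 / 2)) - logLogVar z) := fun hz => by
    linarith [logLogVar_le (by positivity) hz]
  induction k generalizing z with
  | zero => rw [growBEC, expectedStopTime_leaf]; exact hleaf hz
  | succ k ih =>
    rw [growBEC]
    split_ifs with hm
    · obtain ⟨hm0, hm1⟩ := lt_min_iff.1 hm
      have hv : θ / 2 ≤ erasureVar z := by
        unfold erasureVar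
        rcases le_total z (1 / 2) with h | h <;> nlinarith
      have hmul : ∀ {a : ℝ}, θ ≤ a → θ ^ 2 / 2 ≤ erasureVar z * a := fun {a} ha => by
        have := mul_le_mul hv ha hθ.le (by linarith)
        nlinarith
      have hf := ih (z := 2 * z - z ^ 2) (by nlinarith) 
        (by nlinarith [mul_pos (sub_pos.2 h1) (sub_pos.2 h1)])
        (by rw [erasureVar_flat]; exact hmul (by nlinarith))
      have hs := ih (z := z ^ 2) (by positivity) (by nlinarith)
        (by rw [erasureVar_sharp]; exact hmul (by nlinarith))
      rw [expectedStopTime_node]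
      have := logLogVar_drift h0 h1
      linarith
    · rw [expectedStopTime_leaf]; exact hleaf hz

theorem PrunedTree.depth_le {n : ℕ} (T : PrunedTree n) : T.depth ≤ n := by
  induction T with
  | leaf => simp [depth]
  | node l r ihl ihr => simp [depth, ihl, ihr]

/-- Some path never polarizes: taking `♭` when z ≤ 1/2 and `♯` when z ≥ 1/2 keeps z in [a, b]. -/
theorem depth_growBEC {θ a b : ℝ} (hθ : 0 ≤ θ) (ha : θ < a) (hb : θ < 1 - b) (ha' : a ≤ 1 / 4)
    (hb' : 3 / 4 ≤ b) (k : ℕ) {z : ℝ} (h0 : a ≤ z) (h1 : z ≤ b) : (growBEC θ k z).depth = k := by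
  induction k generalizing z with
  | zero => rfl
  | succ k ih =>
    rw [growBEC, if_pos (lt_min (by linarith) (by linarith)), depth]
    have hf := (growBEC θ k (2 * z - z ^ 2)).depth_le
    have hs := (growBEC θ k (z ^ 2)).depth_le
    rcases le_total z (1 / 2) with h | h
    · rw [ih (z := 2 * z - z ^ 2) (by nlinarith) (by nlinarith)]
      omega
    · rw [ih (z := z ^ 2) (by nlinarith) (by nlinarith)]
      omega

/-! ### Estimates in terms of ε -/

theorem ComputableIn.mono {κ ι A : Type} {F : (κ → A) → ι → A} {b b' : ℝ}
    (h : ComputableIn F b) (hb : b ≤ b') : ComputableIn F b' := by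
  obtain ⟨t, S, h1, h2, h3⟩ := h
  exact ⟨t, S, h1, h2, h3.trans hb⟩

theorem zpow_neg_five_eq {ε : ℝ} (h0 : 0 < ε) :
    ε ^ (-5 : ℤ) = 2 ^ (-5 * Real.logb 2 ε) := by
  rw [mul_comm, Real.rpow_mul (by norm_num), Real.rpow_logb (by norm_num) (by norm_num) h0,
    ← Real.rpow_intCast]
  norm_num

theorem zpow_neg_five_le {ε : ℝ} (h0 : 0 < ε) : ε ^ (-5 : ℤ) ≤ 2 ^ maxDepth ε := by
  rw [zpow_neg_five_eq h0, ← Real.rpow_natCast]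
  exact Real.rpow_le_rpow_of_exponent_le (by norm_num) (Nat.le_ceil _)

theorem two_pow_maxDepth_lt {ε : ℝ} (h0 : 0 < ε) (h1 : ε < 1) :
    (2 : ℝ) ^ maxDepth ε < 2 * ε ^ (-5 : ℤ) := by
  have hl := Real.logb_neg (b := 2) (by norm_num) h0 h1
  have := Nat.ceil_lt_add_one (show 0 ≤ -5 * Real.logb 2 ε by linarith)
  rw [zpow_neg_five_eq h0, ← Real.rpow_natCast, mul_comm, ← Real.rpow_add_one (by norm_num)]
  exact Real.rpow_lt_rpow_of_exponent_lt (by norm_num) this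

theorem two_pow_maxDepth_eq {ε : ℝ} (h0 : 0 < ε) {k : ℕ} (hk : ε ^ (-5 : ℤ) = 2 ^ k) :
    (2 : ℝ) ^ maxDepth ε = ε ^ (-5 : ℤ) := by
  have : -5 * Real.logb 2 ε = k := by
    rw [zpow_neg_five_eq h0, ← Real.rpow_natCast] at hk
    have := congrArg (Real.logb 2) hk
    rwa [Real.logb_rpow (by norm_num) (by norm_num),
      Real.logb_rpow (by norm_num) (by norm_num)] at this
  rw [hk, maxDepth, this, Nat.ceil_natCast]

theorem one_div_le_two_pow_maxDepth {ε : ℝ} (h0 : 0 < ε) (h1 : ε < 1) :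
    1 / ε ≤ 2 ^ maxDepth ε := by
  refine le_trans ?_ (zpow_neg_five_le h0)
  rw [one_div, ← zpow_neg_one]
  exact zpow_le_zpow_right_of_le_one₀ h0 h1.le (by norm_num)

theorem threshold_le {ε : ℝ} (h0 : 0 < ε) : ε / 2 ^ maxDepth ε ≤ ε ^ 6 := by
  have := zpow_neg_five_le h0
  rw [div_le_iff₀ (by positivity)]
  calc ε = ε ^ 6 * ε ^ (-5 : ℤ) := by
        rw [← zpow_natCast ε 6, ← zpow_add₀ h0.ne']; norm_num
    _ ≤ _ := by gcongr

theorem le_threshold {ε : ℝ} (h0 : 0 < ε) (h1 : ε < 1) : ε ^ 6 / 2 ≤ ε / 2 ^ maxDepth ε := by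
  have := two_pow_maxDepth_lt h0 h1
  rw [le_div_iff₀ (by positivity)]
  calc ε ^ 6 / 2 * 2 ^ maxDepth ε ≤ ε ^ 6 / 2 * (2 * ε ^ (-5 : ℤ)) := by gcongr
    _ = ε ^ 6 * ε ^ (-5 : ℤ) := by ring
    _ = ε := by rw [← zpow_natCast ε 6, ← zpow_add₀ h0.ne']; norm_num

theorem decayRate_pow_maxDepth_le {ε : ℝ} (h0 : 0 < ε) :
    decayRate ^ maxDepth ε ≤ ε ^ (30 / 29 : ℝ) := by
  have e : decayRate ^ maxDepth ε = (2 ^ maxDepth ε : ℝ) ^ (-(6 / 29) : ℝ) := by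
    rw [decayRate, ← Real.rpow_natCast, ← Real.rpow_natCast, ← Real.rpow_mul (by norm_num),
      ← Real.rpow_mul (by norm_num), mul_comm]
  rw [e]
  refine (Real.rpow_le_rpow_of_nonpos (by positivity) (zpow_neg_five_le h0)
    (by norm_num)).trans_eq ?_
  rw [← Real.rpow_intCast, ← Real.rpow_mul h0.le]
  norm_num

theorem le_polarization {θ z : ℝ} (hθ : 0 ≤ θ) (h0 : θ < z) (h1 : θ < 1 - z) :
    polarizationWeight * (θ / 2) ^ (1 / 200 : ℝ) ≤ polarization z := by
  have hv : θ / 2 ≤ erasureVar z := by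
    unfold erasureVar
    rcases le_total z (1 / 2) with h | h <;> nlinarith
  have := Real.rpow_le_rpow (by positivity) hv (show (0 : ℝ) ≤ 1 / 200 by norm_num)
  have := mul_le_mul_of_nonneg_left this polarizationWeight_pos.le
  unfold polarization
  linarith [Real.sqrt_nonneg (erasureVar z)]

theorem polarization_le {z : ℝ} (h0 : 0 ≤ z) (h1 : z ≤ 1) :
    polarization z ≤ 1 + polarizationWeight := by
  have hq := erasureVar_nonneg h0 h1
  have hq4 := erasureVar_le z
  have h := Real.rpow_le_one hq (by linarith) (show (0 : ℝ) ≤ 1 / 200 by norm_num)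
  have h' : √(erasureVar z) ≤ 1 := Real.sqrt_le_one.2 (by linarith)
  unfold polarization
  nlinarith [polarizationWeight_pos]

/-- The rate is at least the capacity minus the threshold and the probability that a channel is
not yet polarized at the maximal depth. -/
theorem le_rate_maxDepth {ε p : ℝ} (h0 : 0 ≤ p) (h1 : p ≤ 1) (hε0 : 0 < ε) (hε1 : ε < 1) :
    1 - p - ε ^ 6 - 4 * (1 + polarizationWeight) / polarizationWeight *
      ε ^ (13 / 2900 : ℝ) * ε ≤
      (growBEC (ε / 2 ^ maxDepth ε) (maxDepth ε) p).rate := by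
  set θ := ε / 2 ^ maxDepth ε with hθ
  have hw := polarizationWeight_pos
  have hθ0 : 0 < θ := by positivity
  have key := le_rate_growBEC (δ := polarizationWeight * (θ / 2) ^ (1 / 200 : ℝ)) hθ0.le
    (by positivity) (fun z hz hz' => le_polarization hθ0.le hz hz') (maxDepth ε) h0 h1
  have hle := threshold_le hε0
  have hpow : ε ^ (3 / 100 : ℝ) / 4 ≤ (θ / 2) ^ (1 / 200 : ℝ) := by
    have h4 : (4 : ℝ) ^ (1 / 200 : ℝ) ≤ 4 := by
      conv_rhs => rw [← Real.rpow_one 4]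
      exact Real.rpow_le_rpow_of_exponent_le (by norm_num) (by norm_num)
    calc ε ^ (3 / 100 : ℝ) / 4 ≤ ε ^ (3 / 100 : ℝ) / 4 ^ (1 / 200 : ℝ) := by gcongr
      _ = (ε ^ 6 / 4) ^ (1 / 200 : ℝ) := by
        rw [Real.div_rpow (by positivity) (by norm_num), ← Real.rpow_natCast,
          ← Real.rpow_mul hε0.le]
        norm_num
      _ ≤ _ := by
        apply Real.rpow_le_rpow (by positivity) _ (by norm_num)
        linarith [le_threshold hε0 hε1]
  have hfrac : polarization p * decayRate ^ maxDepth ε /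
      (polarizationWeight * (θ / 2) ^ (1 / 200 : ℝ)) ≤
      4 * (1 + polarizationWeight) / polarizationWeight * ε ^ (13 / 2900 : ℝ) * ε := by
    calc _ ≤ (1 + polarizationWeight) * ε ^ (30 / 29 : ℝ) /
          (polarizationWeight * (ε ^ (3 / 100 : ℝ) / 4)) := by
          gcongr
          · unfold decayRate; positivity
          · exact polarization_le h0 h1
          · exact decayRate_pow_maxDepth_le hε0
      _ = _ := by
          -- The decay 30/29 less the Markov loss 6/200 = 3/100 is 1 + 13/2900, so the loss of rate
          -- is o(ε).
          have e : ε ^ (30 / 29 : ℝ) = ε ^ (13 / 2900 : ℝ) * ε * ε ^ (3 / 100 : ℝ) := by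
            conv_rhs => rw [← Real.rpow_one ε, ← Real.rpow_mul hε0.le, ← Real.rpow_mul hε0.le,
              ← Real.rpow_add hε0, ← Real.rpow_add hε0]
            norm_num
          have hpos : 0 < ε ^ (3 / 100 : ℝ) := by positivity
          rw [e]
          field_simp
  linarith

theorem expectedStopTime_growBEC_eq_zero {θ : ℝ} (k : ℕ) {z : ℝ} (h : min z (1 - z) ≤ θ) :
    (growBEC θ k z).expectedStopTime = 0 := by
  cases k with
  | zero => exact expectedStopTime_leaf _
  | succ k => rw [growBEC, if_neg (not_lt.2 h), expectedStopTime_leaf]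

theorem expectedStopTime_maxDepth_le {ε p : ℝ} (h0 : 0 < p) (h1 : p < 1) (hε0 : 0 < ε)
    (hε : ε ≤ 1 / 2) (hp : ε ≤ erasureVar p) (hlog : 1 ≤ Real.log (Real.log (1 / ε))) :
    (growBEC (ε / 2 ^ maxDepth ε) (maxDepth ε) p).expectedStopTime ≤
      192 * Real.log (Real.log (1 / ε)) := by
  set θ := ε / 2 ^ maxDepth ε with hθ
  have hθ0 : 0 < θ := by positivity
  have hle := threshold_le hε0
  have hge := le_threshold hε0 (by linarith)
  have hεp : ε ^ 6 ≤ ε := pow_le_of_le_one hε0.le (by linarith) (by norm_num)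
  have key := expectedStopTime_growBEC_le hθ0 (maxDepth ε) h0 h1 (by nlinarith)
  have hL : -20 ≤ logLogVar p := by
    have h4 := log_four_le (erasureVar_pos h0 h1) (erasureVar_le p)
    have hnn := Real.log_nonneg (show 1 ≤ -Real.log (erasureVar p) by
      linarith [Real.log_two_gt_d9])
    have hs : √(erasureVar p) ≤ 1 / 2 :=
      Real.sqrt_le_iff.2 ⟨by norm_num, by linarith [erasureVar_le p]⟩
    unfold logLogVar
    linarith
  have hy : 0 < Real.log (1 / ε) := Real.log_pos (by rw [lt_div_iff₀ hε0]; linarith)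
  have hθ15 : ε ^ 15 ≤ θ ^ 2 / 2 := by
    have h3 : ε ^ 3 ≤ (1 / 2) ^ 3 := by gcongr
    have h12 : (ε ^ 6 / 2) ^ 2 ≤ θ ^ 2 := by gcongr
    have : 0 < ε ^ 12 := by positivity
    calc ε ^ 15 = ε ^ 12 * ε ^ 3 := by ring
      _ ≤ ε ^ 12 * (1 / 2) ^ 3 := by gcongr
      _ = (ε ^ 6 / 2) ^ 2 / 2 := by ring
      _ ≤ _ := by linarith
  have hlogle : Real.log (-Real.log (θ ^ 2 / 2)) ≤ 3 + Real.log (Real.log (1 / ε)) := by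
    have h15 : -Real.log (θ ^ 2 / 2) ≤ 15 * Real.log (1 / ε) := by
      have := Real.log_le_log (by positivity) hθ15
      rw [Real.log_pow] at this
      rw [one_div, Real.log_inv]
      push_cast at this
      linarith
    have hpos : 0 < -Real.log (θ ^ 2 / 2) := by
      have : Real.log (θ ^ 2 / 2) < 0 := Real.log_neg (by positivity) (by nlinarith)
      linarith
    refine (Real.log_le_log hpos h15).trans ?_
    rw [Real.log_mul (by norm_num) hy.ne']
    have : Real.log 15 ≤ 3 := by
      rw [Real.log_le_iff_le_exp (by norm_num), show (3 : ℝ) = (3 : ℕ) * 1 by norm_num,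
        Real.exp_nat_mul]
      calc (15 : ℝ) ≤ 2.7 ^ 3 := by norm_num
        _ ≤ _ := by gcongr; linarith [Real.exp_one_gt_d9]
    linarith
  -- The total is 8(log log(1/ε) + 3 + 20), at most 8 · 24 = 192 times log log(1/ε) because the
  -- latter is at least 1.
  linarith

/-! ### Choice of the constants and conclusion -/

theorem eventually_loglog : ∀ᶠ ε : ℝ in nhdsWithin 0 (Set.Ioi 0),
    1 ≤ Real.log (Real.log (1 / ε)) := by
  simp_rw [one_div]
  exact (Real.tendsto_log_atTop.comp (Real.tendsto_log_atTop.comp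
    tendsto_inv_nhdsGT_zero)).eventually_ge_atTop 1

theorem eventually_mul_rpow_le (c : ℝ) {a : ℝ} (ha : 0 < a) :
    ∀ᶠ ε : ℝ in nhdsWithin 0 (Set.Ioi 0), c * ε ^ a ≤ 1 / 2 := by
  have h : Filter.Tendsto (fun ε : ℝ => c * ε ^ a) (nhds 0) (nhds (c * 0 ^ a)) :=
    ((Real.continuousAt_rpow_const 0 a (Or.inr ha.le)).tendsto).const_mul c
  rw [Real.zero_rpow ha.ne', mul_zero] at h
  exact (h.mono_left nhdsWithin_le_nhds).eventually_le_const (by norm_num)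

theorem eventually_le_of_pos {P : Prop} {a : ℝ} (h : P → 0 < a) :
    ∀ᶠ ε : ℝ in nhdsWithin 0 (Set.Ioi 0), P → ε ≤ a := by
  by_cases hP : P
  · filter_upwards [nhdsWithin_le_nhds (Iic_mem_nhds (h hP))] with ε hε _ using hε
  · exact Filter.Eventually.of_forall fun _ h' => absurd h' hP

/-- The gates needed for encoding and for decoding, in terms of the dimension. -/
theorem gates_le {n : ℕ} (T : PrunedTree n) {Λ r : ℝ} (hΛ : 1 ≤ Λ) (hr : 0 < r)
    (hT : T.expectedStopTime ≤ 192 * Λ) (hR : r ≤ T.rate) :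
    (4 * T.butterflies + 1 : ℝ) ≤ 400 / r * Λ * T.dimension := by
  have hN : (1 : ℝ) ≤ 2 ^ n := one_le_pow₀ (by norm_num)
  have hb : 2 * (T.butterflies : ℝ) ≤ 192 * Λ * 2 ^ n := by
    rw [T.two_mul_butterflies]
    rwa [expectedStopTime, div_le_iff₀ (by positivity)] at hT
  have hK : r * 2 ^ n ≤ T.dimension := by
    rw [rate, blockLength_eq, le_div_iff₀ (by positivity)] at hR
    exact_mod_cast hR
  -- Here 2 · 192 Λ + 1 ≤ 400 Λ, since Λ ≥ 1.
  calc (4 * T.butterflies + 1 : ℝ) ≤ 400 * Λ * 2 ^ n := by nlinarith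
    _ = 400 / r * Λ * (r * 2 ^ n) := by field_simp
    _ ≤ _ := by gcongr

end PrunedPolar

theorem theorem1 (p : ℝ) (h0 : 0 ≤ p) (h1 : p ≤ 1) :
    ∃ C ε₀ : ℝ, 0 < C ∧ 0 < ε₀ ∧ ∀ ε : ℝ, 0 < ε → ε < ε₀ →
      -- block length
      (ε ^ (-5 : ℤ) ≤ (prunedPolarCode (bec p h0 h1) ε).blockLength ∧
        ((prunedPolarCode (bec p h0 h1) ε).blockLength : ℝ) < 2 * ε ^ (-5 : ℤ) ∧
        (∀ k : ℕ, ε ^ (-5 : ℤ) = 2 ^ k →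
          ((prunedPolarCode (bec p h0 h1) ε).blockLength : ℝ) = ε ^ (-5 : ℤ)) ∧
        (0 < p → p < 1 →
          (prunedPolarCode (bec p h0 h1) ε).blockLength =
            2 ^ (prunedPolarCode (bec p h0 h1) ε).depth)) ∧
      -- code rate
      (bec p h0 h1).capacity - ε ≤ (prunedPolarCode (bec p h0 h1) ε).rate ∧
      -- block error probability, for every message
      (∀ m, (prunedPolarCode (bec p h0 h1) ε).errorProb p h0 h1 m ≤ ε) ∧
      -- expected depth at which the tree stops growing
      (prunedPolarCode (bec p h0 h1) ε).expectedStopTime ≤ C * Real.log (Real.log (1 / ε)) ∧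
      -- encoding and decoding complexity per information bit, in terms of `ε` and of `N`
      (p < 1 →
        0 < (prunedPolarCode (bec p h0 h1) ε).dimension ∧
        ComputableIn (prunedPolarCode (bec p h0 h1) ε).encode
          (C * Real.log (Real.log (1 / ε)) *
            (prunedPolarCode (bec p h0 h1) ε).dimension) ∧
        ComputableIn (prunedPolarCode (bec p h0 h1) ε).decode
          (C * Real.log (Real.log (1 / ε)) *
            (prunedPolarCode (bec p h0 h1) ε).dimension) ∧
        ComputableIn (prunedPolarCode (bec p h0 h1) ε).encode
          (C * Real.log (Real.log (prunedPolarCode (bec p h0 h1) ε).blockLength) *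
            (prunedPolarCode (bec p h0 h1) ε).dimension) ∧
        ComputableIn (prunedPolarCode (bec p h0 h1) ε).decode
          (C * Real.log (Real.log (prunedPolarCode (bec p h0 h1) ε).blockLength) *
            (prunedPolarCode (bec p h0 h1) ε).dimension)) := by
  have hev := (eventually_le_of_pos (P := True) (a := 1 / 2) fun _ => by norm_num).and
    (eventually_loglog.and ((eventually_mul_rpow_le
      (4 * (1 + polarizationWeight) / polarizationWeight)
      (show (0 : ℝ) < 13 / 2900 by norm_num)).and
    ((eventually_le_of_pos (P := 0 < p ∧ p < 1) (a := erasureVar p)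
      fun h => erasureVar_pos h.1 h.2).and
    (eventually_le_of_pos (P := p < 1) (a := (1 - p) / 2) fun h => by linarith))))
  obtain ⟨ε₀, hε₀, hε₀'⟩ := mem_nhdsGT_iff_exists_Ioo_subset.1 hev
  -- At p = 1 the quotient is 0 by convention; the summand 192 keeps the constant positive.
  have hC : 0 ≤ 400 / ((1 - p) / 2) := div_nonneg (by norm_num) (by linarith)
  refine ⟨192 + 400 / ((1 - p) / 2), ε₀, by linarith, hε₀, fun ε hε hlt => ?_⟩
  obtain ⟨hhalf, hlog, hsmall, hvar, hcap⟩ := hε₀' ⟨hε, hlt⟩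
  replace hhalf := hhalf trivial
  have hε1 : ε < 1 := by linarith
  rw [prunedPolarCode_bec, Channel.capacity_bec]
  set θ := ε / 2 ^ maxDepth ε with hθ
  set T := growBEC θ (maxDepth ε) p with hT
  have hN : (T.blockLength : ℝ) = 2 ^ maxDepth ε := by
    rw [PrunedTree.blockLength_eq]; push_cast; rfl
  have hθ0 : 0 < θ := by positivity
  have hθε : ε ^ 6 ≤ ε / 2 := by
    have : ε ^ 5 ≤ (1 / 2) ^ 5 := by gcongr
    nlinarith [pow_succ ε 5]
  have hθle : θ ≤ ε / 2 := (threshold_le hε).trans hθε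
  have hrate : 1 - p - ε ≤ T.rate := by
    have := le_rate_maxDepth h0 h1 hε hε1
    have := mul_le_mul_of_nonneg_right hsmall hε.le
    linarith
  have hτ : T.expectedStopTime ≤ 192 * Real.log (Real.log (1 / ε)) := by
    -- For p = 0 or p = 1 the root is already polarized and the tree is a single leaf.
    rcases h0.eq_or_lt with h | h
    · rw [hT, expectedStopTime_growBEC_eq_zero _ ((min_le_left _ _).trans (by linarith))]
      linarith
    rcases h1.eq_or_lt with h' | h'
    · rw [hT, expectedStopTime_growBEC_eq_zero _ ((min_le_right _ _).trans (by linarith))]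
      linarith
    exact expectedStopTime_maxDepth_le h h' hε hhalf (hvar ⟨h, h'⟩) hlog
  refine ⟨⟨?_, ?_, ?_, ?_⟩, hrate, ?_, ?_, ?_⟩
  · rw [hN]; exact zpow_neg_five_le hε
  · rw [hN]; exact two_pow_maxDepth_lt hε hε1
  · intro k hk
    rw [hN]; exact two_pow_maxDepth_eq hε hk
  · intro hp0 hp1
    have hv := hvar ⟨hp0, hp1⟩
    have hv4 := erasureVar_le p
    rw [PrunedTree.blockLength_eq]
    unfold erasureVar at hv hv4
    -- The interval is widened to contain p; θ lies below p and 1 - p because θ ≤ ε/2 and ε ≤ p(1 -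
    -- p).
    rw [hT, depth_growBEC (a := min p (1 / 4)) (b := max p (3 / 4)) hθ0.le
      (lt_min (by nlinarith) (by linarith)) _ (min_le_right _ _) (le_max_right _ _) _
      (min_le_left _ _) (le_max_left _ _)]
    rw [lt_sub_comm]
    exact max_lt (by nlinarith) (by linarith)
  · intro m
    refine (T.errorProb_le_failProb p h0 h1 m).trans
      ((PrunedTree.failProb_growBEC_le _ h0 h1 hθ0.le).trans_eq ?_)
    rw [hθ]
    field_simp
  · refine hτ.trans (mul_le_mul_of_nonneg_right ?_ (by linarith))
    linarith
  intro hp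
  have hr : 0 < (1 - p) / 2 := by linarith
  have hR : (1 - p) / 2 ≤ T.rate := by linarith [hcap hp]
  have hdim : 0 < T.dimension := by
    refine Nat.pos_of_ne_zero fun h => ?_
    have : T.rate = 0 := by simp [PrunedTree.rate, h]
    linarith
  have hgates := gates_le T hlog hr hτ hR
  have hloglog : Real.log (Real.log (1 / ε)) ≤ Real.log (Real.log T.blockLength) := by
    have hpos : 1 < 1 / ε := by rw [lt_div_iff₀ hε]; linarith
    apply Real.log_le_log (Real.log_pos hpos)
    apply Real.log_le_log (by positivity)
    rw [hN]
    exact one_div_le_two_pow_maxDepth hε hε1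
  have hbound : (4 * T.butterflies + 1 : ℝ) ≤
      (192 + 400 / ((1 - p) / 2)) * Real.log (Real.log (1 / ε)) * T.dimension := by
    refine hgates.trans ?_
    gcongr
    linarith
  have hbound' : (192 + 400 / ((1 - p) / 2)) * Real.log (Real.log (1 / ε)) * T.dimension ≤
      (192 + 400 / ((1 - p) / 2)) * Real.log (Real.log T.blockLength) * T.dimension := by
    gcongr
  have henc : (T.butterflies + 1 : ℝ) ≤ 4 * T.butterflies + 1 := by
    linarith [Nat.cast_nonneg (α := ℝ) T.butterflies]
  exact ⟨hdim, T.computableIn_encode.mono (henc.trans hbound), T.computableIn_decode.mono hbound,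
    T.computableIn_encode.mono (henc.trans (hbound.trans hbound')),
    T.computableIn_decode.mono (hbound.trans hbound')⟩
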